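/- Let $n,p,m\ge 0$, $1\le d\le N$ and $\sigma\in\mathbb R$. On a probability space let $(\omega_k)_{k\ge 0}$ be independent square-integrable real random variables with mean $0$ and variance $\sigma^2$. For $k\ge -1$ let $\mathcal F_{k}$ be the $\sigma$-algebra generated by $\omega_0,\dots,\omega_k$ and the null sets (so $\mathcal F_{-1}$ is generated by the null sets). Consider the system $$x_{k+1}=(A+\omega_k\bar A)x_k+(B+\omega_k\bar B)u_{k-d},\qquad x_k\in\mathbb R^n,\ u_k\in\mathbb R^p,$$ with given deterministic $x_0,u_{-d},\dots,u_{-1}$. A control $u=(u_0,\dots,u_{N-d})$ is admissible if each $u_k$ is $\mathcal F_{k-1}$-measurable and square integrable. For $i=0,1,\dots,m$ let $Q_i,R_i,F_i$ be symmetric positive definite and $$J_i(u)=E\Big[\sum_{k=0}^N x_k^TQ_ix_k+\sum_{k=d}^N u_{k-d}^TR_iu_{k-d}+x_{N+1}^TF_ix_{N+1}\Big].$$ The constrained problem is to minimise $J_0(u)$ over the admissible $u$ with $J_i(u)\le c_i$ for $i=1,\dots,m$, where $c\in\mathbb R^m$. Assume the Slater condition: for every $\lambda\in\mathbb R^m$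 with $\lambda\ge 0$, $\lambda\neq 0$, there is an admissible $u$ with $\sum_{i=1}^m\lambda_i(J_i(u)-c_i)<0$. For $\lambda\ge 0$ put $Q(\lambda)=Q_0+\sum_{i=1}^m\lambda_iQ_i$, $R(\lambda)=R_0+\sum_{i=1}^m\lambda_iR_i$, $F(\lambda)=F_0+\sum_{i=1}^m\lambda_iF_i$, let $Z_{N+1}=X_{N+1}=F(\lambda)$, $L_k=0$ for $k>N$, and for $k=N,N-1,\dots,d$ $$\Upsilon_k=B^TZ_{k+1}B+\sigma^2\bar B^TX_{k+1}\bar B+R(\lambda),\quad M_k=B^TZ_{k+1}A+\sigma^2\bar B^TX_{k+1}\bar A,\quad L_k=M_k^T\Upsilon_k^{-1}M_k,$$ $$Z_k=A^TZ_{k+1}A+\sigma^2\bar A^TX_{k+1}\bar A+Q(\lambda)-L_k,\qquad X_k=Z_k+\sum_{i=0}^{d-1}(A^T)^iL_{k+i}A^i .$$ Put, with $\hat x_{j\mid i}=E[x_j\mid\mathcal F_{i-1}]$, $$\varphi(\lambda)=E\Big[\sum_{k=0}^{d-1}x_k^TQ(\lambda)x_k+x_d^TX_dx_d-\sum_{i=0}^{d-1}x_d^T(A^T)^iL_{d+i}A^i\,\hat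 x_{d\mid i}\Big]-\lambda^Tc ,$$ which depends only on $\lambda$ and the given data. Then the following hold. (a) For every $\lambda\ge 0$ the matrices $\Upsilon_N,\dots,\Upsilon_d$ are positive definite, and $\varphi(\lambda)$ is the minimum over the admissible $u$ of the Lagrangian $J_0(u)+\sum_{i=1}^m\lambda_i(J_i(u)-c_i)$. (b) There is $\lambda^*\ge 0$ that maximises $\varphi$ over all $\lambda\ge 0$. (c) For every such $\lambda^*$, with $Z^*,X^*$ the solution of the recursion for $\lambda^*$, the constrained problem has an optimal control, and an admissible $u^*$ is optimal if and only if, almost surely, $$u_k^*=-\big(B^TZ^*_{k+d+1}B+\sigma^2\bar B^TX^*_{k+d+1}\bar B+R(\lambda^*)\big)^{-1}\big(B^TZ^*_{k+d+1}A+\sigma^2\bar B^TX^*_{k+d+1}\bar A\big)\,\hat x_{k+d\mid k},\qquad k=0,\dots,N-d,$$ where $x$ is the state driven by $u^*$. -/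

import Mathlib

open MeasureTheory ProbabilityTheory Matrix

/-- The data of a finite-horizon linear-quadratic regulation problem with input delay `d`,
multiplicative noise of variance `sigma ^ 2`, state dimension `n`, input dimension `p` and `m`
quadratic constraints. The weights with index `0` belong to the cost, those with index `i.succ`
to the `i`-th constraint. `past j` is the given input `u_{j-d}`, for `j = 0, …, d-1`. -/
structure DelayLQ (n p m : ℕ) where
  A : Matrix (Fin n) (Fin n) ℝ
  Abar : Matrix (Fin n) (Fin n) ℝ
  B : Matrix (Fin n) (Fin p) ℝ
  Bbar : Matrix (Fin n) (Fin p) ℝ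
  sigma : ℝ
  d : ℕ
  N : ℕ
  x0 : Fin n → ℝ
  past : Fin d → Fin p → ℝ
  Q : Fin (m + 1) → Matrix (Fin n) (Fin n) ℝ
  R : Fin (m + 1) → Matrix (Fin p) (Fin p) ℝ
  F : Fin (m + 1) → Matrix (Fin n) (Fin n) ℝ
  c : Fin m → ℝ

/-- The information `σ(w_0, …, w_{k-1})`, augmented by the null sets of `μ`: the measurable sets
that agree almost everywhere with a set of the natural filtration. (On a complete space every set
that agrees almost everywhere with a measurable set is itself measurable.)
With `F_k` the augmented natural filtration, `pastInfo μ w k` is `F_{k-1}`. -/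
@[reducible] def pastInfo {Ω : Type*} [mΩ : MeasurableSpace Ω] (μ : Measure Ω) (w : ℕ → Ω → ℝ) (k : ℕ) :
    MeasurableSpace Ω :=
  eventuallyMeasurableSpace
    (⨆ j : Fin k, MeasurableSpace.comap (w j) (inferInstance : MeasurableSpace ℝ)) (ae μ) ⊓ mΩ

/-- Independent noise with mean zero and variance `s ^ 2`. -/
structure IsWhiteNoise {Ω : Type*} [MeasurableSpace Ω] (μ : Measure Ω) (w : ℕ → Ω → ℝ) (s : ℝ) :
    Prop where
  measurable : ∀ k, Measurable (w k)
  indep : iIndepFun w μ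
  memLp : ∀ k, MemLp (w k) 2 μ
  mean : ∀ k, ∫ ω, w k ω ∂μ = 0
  var : ∀ k, variance (w k) μ = s ^ 2

namespace DelayLQ

variable {n p m : ℕ} (S : DelayLQ n p m)

/-! ### Weights depending on the multiplier -/

/-- `Q(l) = Q_0 + ∑ l_i Q_i`. -/
def Qof (l : Fin m → ℝ) : Matrix (Fin n) (Fin n) ℝ := S.Q 0 + ∑ i, l i • S.Q i.succ

/-- `R(l) = R_0 + ∑ l_i R_i`. -/
def Rof (l : Fin m → ℝ) : Matrix (Fin p) (Fin p) ℝ := S.R 0 + ∑ i, l i • S.R i.succ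

/-- `F(l) = F_0 + ∑ l_i F_i`. -/
def Fof (l : Fin m → ℝ) : Matrix (Fin n) (Fin n) ℝ := S.F 0 + ∑ i, l i • S.F i.succ

/-! ### The backward Riccati-ZXL recursion -/

/-- `Υ` computed from `Z_{k+1} = Z` and `X_{k+1} = X`. -/
noncomputable def upsilonOf (l : Fin m → ℝ) (Z X : Matrix (Fin n) (Fin n) ℝ) :
    Matrix (Fin p) (Fin p) ℝ :=
  S.Bᵀ * Z * S.B + S.sigma ^ 2 • (S.Bbarᵀ * X * S.Bbar) + S.Rof l

/-- `M` computed from `Z_{k+1} = Z` and `X_{k+1} = X`. -/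
noncomputable def gainOf (Z X : Matrix (Fin n) (Fin n) ℝ) : Matrix (Fin p) (Fin n) ℝ :=
  S.Bᵀ * Z * S.A + S.sigma ^ 2 • (S.Bbarᵀ * X * S.Abar)

/-- `L = Mᵀ Υ⁻¹ M` computed from `Z_{k+1} = Z` and `X_{k+1} = X`. -/
noncomputable def ellOf (l : Fin m → ℝ) (Z X : Matrix (Fin n) (Fin n) ℝ) :
    Matrix (Fin n) (Fin n) ℝ :=
  (S.gainOf Z X)ᵀ * (S.upsilonOf l Z X)⁻¹ * S.gainOf Z X

/-- The backward recursion, run for `j` steps from the terminal time `N + 1`. With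
`k = N + 1 - j` the value is `(Z_k, X_k, fun i ↦ L_{k+i})`, where `L_i = 0` for `i > N`. -/
noncomputable def zxl (l : Fin m → ℝ) : ℕ →
    Matrix (Fin n) (Fin n) ℝ × Matrix (Fin n) (Fin n) ℝ × (ℕ → Matrix (Fin n) (Fin n) ℝ)
  | 0 => (S.Fof l, S.Fof l, fun _ => 0)
  | j + 1 =>
    let Z := (zxl l j).1
    let X := (zxl l j).2.1
    let L : ℕ → Matrix (Fin n) (Fin n) ℝ := fun i =>
      Nat.casesOn i (S.ellOf l Z X) (zxl l j).2.2
    let Z' := S.Aᵀ * Z * S.A + S.sigma ^ 2 • (S.Abarᵀ * X * S.Abar) + S.Qof l - L 0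
    (Z', Z' + ∑ i ∈ Finset.range S.d, S.Aᵀ ^ i * L i * S.A ^ i, L)

/-- `Z_k`, for `k ≤ N + 1`. -/
noncomputable def Z (l : Fin m → ℝ) (k : ℕ) : Matrix (Fin n) (Fin n) ℝ :=
  (S.zxl l (S.N + 1 - k)).1

/-- `X_k`, for `k ≤ N + 1`. -/
noncomputable def X (l : Fin m → ℝ) (k : ℕ) : Matrix (Fin n) (Fin n) ℝ :=
  (S.zxl l (S.N + 1 - k)).2.1

/-- `Υ_k = Bᵀ Z_{k+1} B + σ² B̄ᵀ X_{k+1} B̄ + R(l)`, for `k ≤ N`. -/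
noncomputable def Upsilon (l : Fin m → ℝ) (k : ℕ) : Matrix (Fin p) (Fin p) ℝ :=
  S.Bᵀ * S.Z l (k + 1) * S.B + S.sigma ^ 2 • (S.Bbarᵀ * S.X l (k + 1) * S.Bbar) + S.Rof l

/-- `M_k = Bᵀ Z_{k+1} A + σ² B̄ᵀ X_{k+1} Ā`, for `k ≤ N`. -/
noncomputable def M (l : Fin m → ℝ) (k : ℕ) : Matrix (Fin p) (Fin n) ℝ :=
  S.Bᵀ * S.Z l (k + 1) * S.A + S.sigma ^ 2 • (S.Bbarᵀ * S.X l (k + 1) * S.Abar)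

/-- `L_k = M_kᵀ Υ_k⁻¹ M_k` for `k ≤ N`, and `L_k = 0` beyond the horizon. -/
noncomputable def L (l : Fin m → ℝ) (k : ℕ) : Matrix (Fin n) (Fin n) ℝ :=
  if k ≤ S.N then (S.M l k)ᵀ * (S.Upsilon l k)⁻¹ * S.M l k else 0

/-! The sequences above solve the Riccati-ZXL equations. -/

theorem Z_terminal (l : Fin m → ℝ) : S.Z l (S.N + 1) = S.Fof l := by
  simp [Z, zxl]

theorem X_terminal (l : Fin m → ℝ) : S.X l (S.N + 1) = S.Fof l := by
  simp [X, zxl]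

theorem zxl_L (l : Fin m → ℝ) (j : ℕ) (hj : j ≤ S.N + 1) (i : ℕ) :
    (S.zxl l j).2.2 i = S.L l (S.N + 1 - j + i) := by
  induction j generalizing i with
  | zero =>
    have h : ¬ (S.N + 1 + i ≤ S.N) := by omega
    simp [zxl, L, h]
  | succ j ih =>
    cases i with
    | zero =>
      have h : S.N - j ≤ S.N := by omega
      have h2 : S.N + 1 - (S.N - j + 1) = j := by omega
      simp [zxl, L, ellOf, gainOf, upsilonOf, M, Upsilon, Z, X, h2]
    | succ i =>
      have h := ih (by omega) i
      have h2 : S.N + 1 - (j + 1) + (i + 1) = S.N + 1 - j + i := by omega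
      rw [h2, ← h]
      simp [zxl]

theorem Z_step (l : Fin m → ℝ) (k : ℕ) (hk : k ≤ S.N) :
    S.Z l k = S.Aᵀ * S.Z l (k + 1) * S.A + S.sigma ^ 2 • (S.Abarᵀ * S.X l (k + 1) * S.Abar)
      + S.Qof l - S.L l k := by
  obtain ⟨j, hj⟩ : ∃ j, S.N + 1 - k = j + 1 := ⟨S.N - k, by omega⟩
  have h2 : S.N + 1 - (k + 1) = j := by omega
  simp [Z, X, L, M, Upsilon, hj, h2, hk, zxl, ellOf, gainOf, upsilonOf]

theorem X_step (l : Fin m → ℝ) (k : ℕ) (hk : k ≤ S.N) :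
    S.X l k = S.Z l k + ∑ i ∈ Finset.range S.d, S.Aᵀ ^ i * S.L l (k + i) * S.A ^ i := by
  have h3 : ∀ i, S.L l (k + i) = (S.zxl l (S.N + 1 - k)).2.2 i := by
    intro i
    rw [zxl_L _ _ _ (by omega)]
    congr 1
    omega
  obtain ⟨j, hj⟩ : ∃ j, S.N + 1 - k = j + 1 := ⟨S.N - k, by omega⟩
  simp only [h3, X, Z, hj, zxl]

/-! ### The controlled system -/

variable {Ω : Type*}

/-- The input `u_{k-d}` that acts at time `k`: given data for `k < d`, the control afterwards. -/
def input (u : ℕ → Ω → Fin p → ℝ) (k : ℕ) (ω : Ω) : Fin p → ℝ :=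
  if h : k < S.d then S.past ⟨k, h⟩ else u (k - S.d) ω

/-- The state: `x_{k+1} = (A + w_k Ā) x_k + (B + w_k B̄) u_{k-d}`. -/
noncomputable def state (w : ℕ → Ω → ℝ) (u : ℕ → Ω → Fin p → ℝ) : ℕ → Ω → Fin n → ℝ
  | 0, _ => S.x0
  | k + 1, ω => (S.A + w k ω • S.Abar) *ᵥ state w u k ω + (S.B + w k ω • S.Bbar) *ᵥ S.input u k ω

/-- The state at the times `k ≤ d`, when no control has acted yet; it is determined by `x_0`,
the given inputs and the noise (see `state_eq_initState`). -/
noncomputable def initState (w : ℕ → Ω → ℝ) : ℕ → Ω → Fin n → ℝ := S.state w (fun _ _ => 0)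

theorem state_eq_initState (w : ℕ → Ω → ℝ) (u : ℕ → Ω → Fin p → ℝ) (k : ℕ) (hk : k ≤ S.d) :
    S.state w u k = S.initState w k := by
  induction k with
  | zero => rfl
  | succ k ih =>
    funext ω
    have h := ih (by omega)
    have h2 : k < S.d := by omega
    simp only [initState] at h ⊢
    simp [state, h, input, h2]

variable [MeasurableSpace Ω] (μ : Measure Ω) (w : ℕ → Ω → ℝ)

/-- Admissible controls: each `u_k`, `k = 0, …, N - d`, is `F_{k-1}`-measurable and square
integrable. (The values `u_k` with `k > N - d` never act.) -/
def Admissible (u : ℕ → Ω → Fin p → ℝ) : Prop :=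
  ∀ k, k + S.d ≤ S.N → Measurable[pastInfo μ w k] (u k) ∧ MemLp (u k) 2 μ

/-- The functional `J_i`: the cost for `i = 0`, a constraint functional for `i ≠ 0`. -/
noncomputable def J (i : Fin (m + 1)) (u : ℕ → Ω → Fin p → ℝ) : ℝ :=
  ∫ ω, ((∑ k ∈ Finset.range (S.N + 1), S.state w u k ω ⬝ᵥ S.Q i *ᵥ S.state w u k ω)
    + (∑ k ∈ Finset.Icc S.d S.N, u (k - S.d) ω ⬝ᵥ S.R i *ᵥ u (k - S.d) ω)
    + S.state w u (S.N + 1) ω ⬝ᵥ S.F i *ᵥ S.state w u (S.N + 1) ω) ∂μ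

/-- The Lagrangian `J_0(u) + ∑ l_i (J_i(u) - c_i)`. -/
noncomputable def lagrangian (l : Fin m → ℝ) (u : ℕ → Ω → Fin p → ℝ) : ℝ :=
  S.J μ w 0 u + ∑ i : Fin m, l i * (S.J μ w i.succ u - S.c i)

/-- Slater condition. -/
def Slater : Prop :=
  ∀ l : Fin m → ℝ, 0 ≤ l → l ≠ 0 →
    ∃ u, S.Admissible μ w u ∧ ∑ i : Fin m, l i * (S.J μ w i.succ u - S.c i) < 0

/-- Controls that satisfy the constraints. -/
def Feasible (u : ℕ → Ω → Fin p → ℝ) : Prop :=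
  S.Admissible μ w u ∧ ∀ i : Fin m, S.J μ w i.succ u ≤ S.c i

/-- Solutions of the constrained problem. -/
def IsOptimalControl (u : ℕ → Ω → Fin p → ℝ) : Prop :=
  S.Feasible μ w u ∧ ∀ v, S.Feasible μ w v → S.J μ w 0 u ≤ S.J μ w 0 v

/-- The parameterised optimal cost
`E[∑_{k<d} x_kᵀ Q(l) x_k + x_dᵀ X_d x_d - ∑_{i<d} x_dᵀ (Aᵀ)^i L_{d+i} A^i E[x_d | F_{i-1}]] - lᵀ c`.
For `d = 1` the last sum is `x_dᵀ (X_d - Z_d) E[x_d | F_{-1}]`. -/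
noncomputable def dualCost (l : Fin m → ℝ) : ℝ :=
  (∫ ω, ((∑ k ∈ Finset.range S.d, S.initState w k ω ⬝ᵥ S.Qof l *ᵥ S.initState w k ω)
    + S.initState w S.d ω ⬝ᵥ S.X l S.d *ᵥ S.initState w S.d ω
    - ∑ i ∈ Finset.range S.d, S.initState w S.d ω ⬝ᵥ
        (S.Aᵀ ^ i * S.L l (S.d + i) * S.A ^ i) *ᵥ (μ[S.initState w S.d | pastInfo μ w i]) ω) ∂μ)
  - ∑ i, l i * S.c i

/-- Solutions of the dual problem: maximise the parameterised optimal cost over `l ≥ 0`. -/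
def IsOptimalMultiplier (l : Fin m → ℝ) : Prop :=
  0 ≤ l ∧ ∀ l', 0 ≤ l' → S.dualCost μ w l' ≤ S.dualCost μ w l

/-- The feedback law `u_k = -Υ_{k+d}⁻¹ M_{k+d} E[x_{k+d} | F_{k-1}]`, `k = 0, …, N - d`, in which
`x` is the state driven by `u` itself. -/
def IsFeedback (l : Fin m → ℝ) (u : ℕ → Ω → Fin p → ℝ) : Prop :=
  ∀ k, k + S.d ≤ S.N → u k =ᵐ[μ] fun ω =>
    -(((S.Upsilon l (k + S.d))⁻¹ * S.M l (k + S.d)) *ᵥ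
      (μ[S.state w u (k + S.d) | pastInfo μ w k]) ω)

end DelayLQ

set_option linter.unusedSectionVars false

/-! ### Quadratic forms of real matrices -/

/-! For a fixed multiplier the Lagrangian is one linear-quadratic cost with weights Q(l), R(l),
F(l), up to the constant lᵀc, and it is minimised by completing squares. The noise at time t is
centred and independent of the state x_t and of the input v that acts at t. Hence E[x_{t+1}ᵀ X
x_{t+1}] splits into a noiseless part and σ² times a noisy part. Conditioning x_{t+1} on the levels
up to t at which v is known removes the noise and leaves A x̂ + B v. The prediction terms subtracted
in `costToGo` therefore change X into Z in the noiseless part only, which is why the recursion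
carries two matrices. The surviving prediction terms shift by one index: at the top level the
prediction is exact, and the term at the bottom level completes the square in v against E[x_t |
F_{t-d-1}]. This is `costToGo_eq`. Summed over time it gives `lagrangian_eq`: the Lagrangian is the
dual cost plus nonnegative losses that vanish exactly under the feedback law.

The dual function is a pointwise minimum of functions affine in the multiplier, hence upper
semicontinuous. The Slater condition and compactness of the simplex push it below its value at 0 far
from the origin, so a maximiser exists (`exists_dual_maximizer`).

Differentiating the dual function is avoided. The state is affine in the control, so the midpoint
identity `J_midpoint` makes the Lagrangian grow quadratically away from a minimiser
(`lagrangian_growth`), while every functional is continuous for the same gap (`J_continuous`). A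
minimiser for a slightly perturbed multiplier is then compared with the feedback control, and
maximality of the multiplier yields feasibility and complementary slackness
(`kkt_of_dual_maximizer`). Weak duality turns this into optimality. Since there is no duality gap,
every optimal control minimises the Lagrangian and so obeys the feedback law. -/

theorem mulVec_dotProduct_mulVec {ι κ ι' κ' : Type*} [Fintype ι] [Fintype κ] [Fintype ι']
    [Fintype κ'] (P : Matrix ι κ ℝ) (M : Matrix ι ι' ℝ) (P' : Matrix ι' κ' ℝ) (a : κ → ℝ)
    (b : κ' → ℝ) : (P *ᵥ a) ⬝ᵥ M *ᵥ (P' *ᵥ b) = a ⬝ᵥ (Pᵀ * M * P') *ᵥ b := by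
  rw [← mulVec_mulVec, ← mulVec_mulVec, dotProduct_mulVec a, vecMul_transpose]

theorem dotProduct_mulVec_transpose {ι κ : Type*} [Fintype ι] [Fintype κ]
    (M : Matrix ι κ ℝ) (a : ι → ℝ) (b : κ → ℝ) : a ⬝ᵥ M *ᵥ b = b ⬝ᵥ Mᵀ *ᵥ a := by
  rw [dotProduct_comm, ← dotProduct_transpose_mulVec, dotProduct_comm]
  simp

theorem Matrix.PosSemidef.dotProduct_mulVec_self_nonneg {ι : Type*} [Fintype ι]
    {M : Matrix ι ι ℝ} (hM : M.PosSemidef) (x : ι → ℝ) : 0 ≤ x ⬝ᵥ M *ᵥ x := by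
  simpa using hM.dotProduct_mulVec_nonneg x

theorem Matrix.PosDef.dotProduct_mulVec_self_pos {ι : Type*} [Fintype ι]
    {M : Matrix ι ι ℝ} (hM : M.PosDef) {x : ι → ℝ} (hx : x ≠ 0) : 0 < x ⬝ᵥ M *ᵥ x := by
  simpa using hM.dotProduct_mulVec_pos hx

theorem Matrix.PosDef.eq_zero_of_dotProduct_mulVec_self {ι : Type*} [Fintype ι]
    {M : Matrix ι ι ℝ} (hM : M.PosDef) {x : ι → ℝ} (hx : x ⬝ᵥ M *ᵥ x = 0) : x = 0 := by
  by_contra h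
  exact (hM.dotProduct_mulVec_self_pos h).ne' hx

theorem Matrix.PosSemidef.transpose_eq {ι : Type*} [Fintype ι]
    {M : Matrix ι ι ℝ} (hM : M.PosSemidef) : Mᵀ = M := by
  simpa [IsHermitian] using hM.isHermitian.eq

theorem Matrix.PosSemidef.of_transpose_eq {ι : Type*} [Fintype ι] {M : Matrix ι ι ℝ}
    (h : Mᵀ = M) (h' : ∀ x : ι → ℝ, 0 ≤ x ⬝ᵥ M *ᵥ x) : M.PosSemidef :=
  .of_dotProduct_mulVec_nonneg (by simpa [IsHermitian] using h) (by simpa using h')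

theorem Matrix.PosSemidef.transpose_mul_mul_same {ι κ : Type*} [Fintype ι] [Fintype κ]
    {M : Matrix ι ι ℝ} (hM : M.PosSemidef) (P : Matrix ι κ ℝ) : (Pᵀ * M * P).PosSemidef := by
  simpa using hM.conjTranspose_mul_mul_same P

theorem dotProduct_mulVec_add_smul {ι : Type*} [Fintype ι] (M : Matrix ι ι ℝ) (s t : ℝ)
    (x y : ι → ℝ) : (s • x + t • y) ⬝ᵥ M *ᵥ (s • x + t • y)
      = s ^ 2 * (x ⬝ᵥ M *ᵥ x) + s * t * (x ⬝ᵥ M *ᵥ y + y ⬝ᵥ M *ᵥ x)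
        + t ^ 2 * (y ⬝ᵥ M *ᵥ y) := by
  simp only [mulVec_add, mulVec_smul, add_dotProduct, dotProduct_add, smul_dotProduct,
    dotProduct_smul, smul_eq_mul]
  ring

/-- Completion of the square. -/
theorem complete_square {ι κ : Type*} [Fintype ι] [Fintype κ] [DecidableEq ι]
    {U : Matrix ι ι ℝ} (hU : U.PosDef) (M : Matrix ι κ ℝ) (v : ι → ℝ) (x : κ → ℝ) :
    v ⬝ᵥ U *ᵥ v + 2 * (v ⬝ᵥ M *ᵥ x)
      = (v + (U⁻¹ * M) *ᵥ x) ⬝ᵥ U *ᵥ (v + (U⁻¹ * M) *ᵥ x) - x ⬝ᵥ (Mᵀ * U⁻¹ * M) *ᵥ x := by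
  have hdet : IsUnit U.det := (isUnit_iff_isUnit_det U).1 hU.isUnit
  have hUt : Uᵀ = U := hU.posSemidef.transpose_eq
  have h1 : U * (U⁻¹ * M) = M := by rw [← Matrix.mul_assoc, mul_nonsing_inv _ hdet, Matrix.one_mul]
  have h2 : (U⁻¹ * M)ᵀ * U = Mᵀ := by
    rw [transpose_mul, transpose_nonsing_inv, hUt, Matrix.mul_assoc, nonsing_inv_mul _ hdet,
      Matrix.mul_one]
  have h3 : ((U⁻¹ * M) *ᵥ x) ⬝ᵥ U *ᵥ v = v ⬝ᵥ M *ᵥ x := by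
    rw [dotProduct_mulVec_transpose, hUt, mulVec_mulVec, h1]
  have h4 : ((U⁻¹ * M) *ᵥ x) ⬝ᵥ U *ᵥ ((U⁻¹ * M) *ᵥ x) = x ⬝ᵥ (Mᵀ * U⁻¹ * M) *ᵥ x := by
    rw [mulVec_dotProduct_mulVec, h2, Matrix.mul_assoc]
  have h5 : v ⬝ᵥ U *ᵥ ((U⁻¹ * M) *ᵥ x) = v ⬝ᵥ M *ᵥ x := by
    rw [mulVec_mulVec, h1]
  rw [mulVec_add, add_dotProduct, dotProduct_add, dotProduct_add, h3, h4, h5]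
  ring

theorem Matrix.PosSemidef.sum_univ {ι κ : Type*} [Fintype ι] [Fintype κ]
    {M : κ → Matrix ι ι ℝ} (h : ∀ i, (M i).PosSemidef) (s : Finset κ) :
    (∑ i ∈ s, M i).PosSemidef := by
  classical
  induction s using Finset.induction_on with
  | empty => simpa using PosSemidef.zero
  | insert a s ha ih => rw [Finset.sum_insert ha]; exact (h a).add ih

/-- A positive definite form dominates every other one, up to a constant. -/
theorem Matrix.PosDef.exists_dominate {ι : Type*} [Fintype ι] {P : Matrix ι ι ℝ}
    (hP : P.PosDef) (M : Matrix ι ι ℝ) :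
    ∃ C : ℝ, 0 < C ∧ ∀ x : ι → ℝ, x ⬝ᵥ M *ᵥ x ≤ C * (x ⬝ᵥ P *ᵥ x) := by
  have hcont : ∀ M : Matrix ι ι ℝ, Continuous fun x : ι → ℝ => x ⬝ᵥ M *ᵥ x := fun M => by
    unfold dotProduct mulVec dotProduct; fun_prop
  have hpos : ∀ x ∈ Metric.sphere (0 : ι → ℝ) 1, 0 < x ⬝ᵥ P *ᵥ x := fun x hx =>
    hP.dotProduct_mulVec_self_pos (by rintro rfl; simp at hx)
  -- The quotient of the two forms is homogeneous of degree zero, so a bound on the compact unit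
  -- sphere suffices.
  obtain ⟨C, hC⟩ := (isCompact_sphere (0 : ι → ℝ) 1).bddAbove_image
    (f := fun x => (x ⬝ᵥ M *ᵥ x) / (x ⬝ᵥ P *ᵥ x))
    ((hcont M).continuousOn.div (hcont P).continuousOn fun x hx => (hpos x hx).ne')
  refine ⟨max C 1, by positivity, fun x => ?_⟩
  by_cases hx : x = 0
  · simp [hx]
  have hn : ‖x‖ ≠ 0 := by simpa using hx
  have hy : ‖x‖⁻¹ • x ∈ Metric.sphere (0 : ι → ℝ) 1 := by
    simp [norm_smul, hn]
  have h1 := (div_le_iff₀ (hpos _ hy)).1 ((hC ⟨_, hy, rfl⟩).trans (le_max_left C 1))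
  simp only [mulVec_smul, dotProduct_smul, smul_dotProduct, smul_eq_mul] at h1
  have h2 : 0 < ‖x‖⁻¹ * ‖x‖⁻¹ := by positivity
  refine le_of_mul_le_mul_left ?_ h2
  linarith

namespace DelayLQ

variable {n p m : ℕ} (S : DelayLQ n p m)

/-! ### Positivity of the weights and of the Riccati sequences -/

theorem posDef_weight {ι : Type*} [Fintype ι] {P : Fin (m + 1) → Matrix ι ι ℝ}
    (hP : ∀ i, (P i).PosDef) {l : Fin m → ℝ} (hl : 0 ≤ l) :
    (P 0 + ∑ i, l i • P i.succ).PosDef :=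
  (hP 0).add_posSemidef (.sum_univ (fun i => (hP i.succ).posSemidef.smul (hl i)) _)

variable {S}

theorem upsilonOf_posDef (hR : ∀ i, (S.R i).PosDef) {l : Fin m → ℝ} (hl : 0 ≤ l)
    {Z X : Matrix (Fin n) (Fin n) ℝ} (hZ : Z.PosSemidef) (hX : X.PosSemidef) :
    (S.upsilonOf l Z X).PosDef :=
  .posSemidef_add ((hZ.transpose_mul_mul_same _).add
    ((hX.transpose_mul_mul_same _).smul (sq_nonneg _))) (posDef_weight hR hl)

theorem ellOf_posSemidef (hR : ∀ i, (S.R i).PosDef) {l : Fin m → ℝ} (hl : 0 ≤ l)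
    {Z X : Matrix (Fin n) (Fin n) ℝ} (hZ : Z.PosSemidef) (hX : X.PosSemidef) :
    (S.ellOf l Z X).PosSemidef :=
  (upsilonOf_posDef hR hl hZ hX).inv.posSemidef.transpose_mul_mul_same _

/-- One step of the cost-to-go, as a quadratic form in the state `x` and the input `v`. -/
theorem stage_expand {Z X : Matrix (Fin n) (Fin n) ℝ} (hZ : Zᵀ = Z) (hX : Xᵀ = X)
    (l : Fin m → ℝ) (x : Fin n → ℝ) (v : Fin p → ℝ) :
    (S.A *ᵥ x + S.B *ᵥ v) ⬝ᵥ Z *ᵥ (S.A *ᵥ x + S.B *ᵥ v)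
      + S.sigma ^ 2 * ((S.Abar *ᵥ x + S.Bbar *ᵥ v) ⬝ᵥ X *ᵥ (S.Abar *ᵥ x + S.Bbar *ᵥ v))
      + v ⬝ᵥ S.Rof l *ᵥ v
    = x ⬝ᵥ (S.Aᵀ * Z * S.A + S.sigma ^ 2 • (S.Abarᵀ * X * S.Abar)) *ᵥ x
      + (v ⬝ᵥ S.upsilonOf l Z X *ᵥ v + 2 * (v ⬝ᵥ S.gainOf Z X *ᵥ x)) := by
  have h1 : x ⬝ᵥ (S.Aᵀ * Z * S.B) *ᵥ v = v ⬝ᵥ (S.Bᵀ * Z * S.A) *ᵥ x := by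
    rw [dotProduct_mulVec_transpose]; simp [transpose_mul, hZ, Matrix.mul_assoc]
  have h2 : x ⬝ᵥ (S.Abarᵀ * X * S.Bbar) *ᵥ v = v ⬝ᵥ (S.Bbarᵀ * X * S.Abar) *ᵥ x := by
    rw [dotProduct_mulVec_transpose]; simp [transpose_mul, hX, Matrix.mul_assoc]
  simp only [upsilonOf, gainOf, mulVec_add, add_dotProduct, dotProduct_add,
    mulVec_dotProduct_mulVec, add_mulVec, smul_mulVec, dotProduct_smul, smul_eq_mul, h1, h2]
  ring

variable (S) in
/-- All the weights of the cost and of the constraints are positive definite. -/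
structure PositiveWeights : Prop where
  Q : ∀ i, (S.Q i).PosDef
  R : ∀ i, (S.R i).PosDef
  F : ∀ i, (S.F i).PosDef

/-- The form of the new Z at x is the minimum over inputs v of a one-step cost built from positive
semidefinite matrices. The difference with L is therefore nonnegative although L is subtracted. -/
theorem PositiveWeights.zxl_posSemidef (hW : S.PositiveWeights) {l : Fin m → ℝ}
    (hl : 0 ≤ l) (j : ℕ) :
    (S.zxl l j).1.PosSemidef ∧ (S.zxl l j).2.1.PosSemidef
      ∧ ∀ i, ((S.zxl l j).2.2 i).PosSemidef := by
  induction j with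
  | zero =>
    have h : (S.Fof l).PosSemidef := (posDef_weight hW.F hl).posSemidef
    exact ⟨h, h, fun _ => PosSemidef.zero⟩
  | succ j ih =>
    obtain ⟨hZ, hX, hL⟩ := ih
    have hE := ellOf_posSemidef hW.R hl hZ hX
    have hU := upsilonOf_posDef hW.R hl hZ hX
    have hL' : ∀ i, ((S.zxl l (j + 1)).2.2 i).PosSemidef := fun i => by
      cases i with
      | zero => exact hE
      | succ i => exact hL i
    have hZ' : (S.zxl l (j + 1)).1.PosSemidef := by
      change (S.Aᵀ * (S.zxl l j).1 * S.A + S.sigma ^ 2 • (S.Abarᵀ * (S.zxl l j).2.1 * S.Abar)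
        + S.Qof l - S.ellOf l (S.zxl l j).1 (S.zxl l j).2.1).PosSemidef
      generalize (S.zxl l j).1 = Z at *
      generalize (S.zxl l j).2.1 = X at *
      have hQl : (S.Qof l).PosSemidef := (posDef_weight hW.Q hl).posSemidef
      have hRl : (S.Rof l).PosSemidef := (posDef_weight hW.R hl).posSemidef
      refine .of_transpose_eq ?_ fun x => ?_
      · rw [transpose_sub, hE.transpose_eq, (((hZ.transpose_mul_mul_same S.A).add
          ((hX.transpose_mul_mul_same S.Abar).smul (sq_nonneg _))).add hQl).transpose_eq]
      -- The minimising input: the completed square vanishes and the remaining value is a sum of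
      -- nonnegative terms.
      · set v : Fin p → ℝ := -(((S.upsilonOf l Z X)⁻¹ * S.gainOf Z X) *ᵥ x) with hv
        have h1 := S.stage_expand hZ.transpose_eq hX.transpose_eq l x v
        rw [complete_square hU, hv, neg_add_cancel, mulVec_zero, dotProduct_zero, ← hv] at h1
        have h2 := hZ.dotProduct_mulVec_self_nonneg (S.A *ᵥ x + S.B *ᵥ v)
        have h3 := hX.dotProduct_mulVec_self_nonneg (S.Abar *ᵥ x + S.Bbar *ᵥ v)
        have h4 := hRl.dotProduct_mulVec_self_nonneg v
        have h5 := hQl.dotProduct_mulVec_self_nonneg x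
        have h6 := mul_nonneg (sq_nonneg S.sigma) h3
        rw [sub_mulVec, add_mulVec, dotProduct_sub, dotProduct_add, ellOf]
        linarith
    refine ⟨hZ', ?_, hL'⟩
    change ((S.zxl l (j + 1)).1
      + ∑ i ∈ Finset.range S.d, S.Aᵀ ^ i * (S.zxl l (j + 1)).2.2 i * S.A ^ i).PosSemidef
    refine hZ'.add (Finset.sum_induction _ PosSemidef (fun _ _ => PosSemidef.add)
      PosSemidef.zero fun i _ => ?_)
    rw [← transpose_pow]
    exact (hL' i).transpose_mul_mul_same _

namespace PositiveWeights

variable {l : Fin m → ℝ}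

theorem Z_posSemidef (hW : S.PositiveWeights) (hl : 0 ≤ l) (k : ℕ) : (S.Z l k).PosSemidef :=
  (hW.zxl_posSemidef hl _).1

theorem X_posSemidef (hW : S.PositiveWeights) (hl : 0 ≤ l) (k : ℕ) : (S.X l k).PosSemidef :=
  (hW.zxl_posSemidef hl _).2.1

theorem Upsilon_posDef (hW : S.PositiveWeights) (hl : 0 ≤ l) (k : ℕ) : (S.Upsilon l k).PosDef :=
  upsilonOf_posDef hW.R hl (hW.Z_posSemidef hl _) (hW.X_posSemidef hl _)

theorem L_posSemidef (hW : S.PositiveWeights) (hl : 0 ≤ l) (k : ℕ) : (S.L l k).PosSemidef := by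
  unfold L
  split_ifs
  · exact (hW.Upsilon_posDef hl k).inv.posSemidef.transpose_mul_mul_same _
  · exact PosSemidef.zero

end PositiveWeights

end DelayLQ

/-! ### Information and noise -/

section Noise

variable {Ω : Type*} [mΩ : MeasurableSpace Ω] {μ : Measure Ω} {w : ℕ → Ω → ℝ} {s : ℝ}

theorem pastInfo_le (k : ℕ) : pastInfo μ w k ≤ mΩ := inf_le_right

theorem pastInfo_mono {j k : ℕ} (h : j ≤ k) : pastInfo μ w j ≤ pastInfo μ w k := by
  refine inf_le_inf_right _ ?_
  rintro t ⟨t', ht', hst⟩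
  refine ⟨t', ?_, hst⟩
  have hle : (⨆ i : Fin j, MeasurableSpace.comap (w i) (inferInstance : MeasurableSpace ℝ))
      ≤ ⨆ i : Fin k, MeasurableSpace.comap (w i) (inferInstance : MeasurableSpace ℝ) :=
    iSup_le fun i => le_iSup
      (fun i : Fin k => MeasurableSpace.comap (w i) (inferInstance : MeasurableSpace ℝ))
      (Fin.castLE h i)
  exact hle _ ht'

namespace IsWhiteNoise

theorem measurable_pastInfo (hw : IsWhiteNoise μ w s) (k : ℕ) :
    Measurable[pastInfo μ w (k + 1)] (w k) := by
  rw [measurable_iff_comap_le]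
  refine le_inf ?_ (hw.measurable k).comap_le
  exact (le_iSup (fun i : Fin (k + 1) =>
    MeasurableSpace.comap (w i) (inferInstance : MeasurableSpace ℝ)) (Fin.last k)).trans
      le_eventuallyMeasurableSpace

/-- Independence involves only measures of sets, so each set of the augmented σ-algebra may be
replaced by an almost everywhere equal set of the natural one. -/
theorem indep_pastInfo (hw : IsWhiteNoise μ w s) (k : ℕ) :
    Indep (MeasurableSpace.comap (w k) inferInstance) (pastInfo μ w k) μ := by
  have h1 : Indep (⨆ i ∈ ({k} : Set ℕ), MeasurableSpace.comap (w i) inferInstance)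
      (⨆ i ∈ Set.Iio k, MeasurableSpace.comap (w i) inferInstance) μ :=
    indep_iSup_of_disjoint (fun i => (hw.measurable i).comap_le) hw.indep (by simp)
  rw [Indep_iff] at h1 ⊢
  rintro a b ha ⟨⟨b', hb', hbb⟩, -⟩
  have hle : (⨆ i : Fin k, MeasurableSpace.comap (w i) (inferInstance : MeasurableSpace ℝ))
      ≤ ⨆ i ∈ Set.Iio k, MeasurableSpace.comap (w i) (inferInstance : MeasurableSpace ℝ) :=
    iSup_le fun i => le_iSup₂
      (f := fun i (_ : i ∈ Set.Iio k) =>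
        MeasurableSpace.comap (w i) (inferInstance : MeasurableSpace ℝ)) i.1 i.2
  have := h1 a b' (by rwa [iSup_singleton]) (hle _ hb')
  rwa [measure_congr hbb, measure_congr ((Filter.EventuallyEq.refl _ a).inter hbb)]

theorem indepFun (hw : IsWhiteNoise μ w s) {β : Type*} [MeasurableSpace β] {k : ℕ} {g : Ω → β}
    (hg : Measurable[pastInfo μ w k] g) : IndepFun (w k) g μ :=
  indep_of_indep_of_le_right (hw.indep_pastInfo k) hg.comap_le

theorem integral_sq (hw : IsWhiteNoise μ w s) [IsProbabilityMeasure μ] (k : ℕ) :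
    ∫ ω, w k ω ^ 2 ∂μ = s ^ 2 := by
  rw [← hw.var k, variance_of_integral_eq_zero (hw.measurable k).aemeasurable (hw.mean k)]

theorem integral_mul_eq_zero (hw : IsWhiteNoise μ w s) {k : ℕ} {g : Ω → ℝ}
    (hg : Measurable[pastInfo μ w k] g) :
    ∫ ω, w k ω * g ω ∂μ = 0 := by
  rw [(hw.indepFun hg).integral_fun_mul_eq_mul_integral (hw.measurable k).aestronglyMeasurable
    (hg.mono (pastInfo_le k) le_rfl).aestronglyMeasurable, hw.mean, zero_mul]

theorem integral_sq_mul (hw : IsWhiteNoise μ w s) [IsProbabilityMeasure μ] {k : ℕ} {g : Ω → ℝ}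
    (hg : Measurable[pastInfo μ w k] g) :
    ∫ ω, w k ω ^ 2 * g ω ∂μ = s ^ 2 * ∫ ω, g ω ∂μ := by
  have h : IndepFun (fun ω => w k ω ^ 2) g μ :=
    (hw.indepFun hg).comp (φ := fun x => x ^ 2) (ψ := id) (by fun_prop) measurable_id
  rw [h.integral_fun_mul_eq_mul_integral ((hw.measurable k).pow_const 2).aestronglyMeasurable
    (hg.mono (pastInfo_le k) le_rfl).aestronglyMeasurable, hw.integral_sq]

/-- Second moments suffice: the squares of the noise and of g are independent and integrable, so
their product is integrable. -/
theorem memLp_smul (hw : IsWhiteNoise μ w s) [IsProbabilityMeasure μ] {ι : Type*} [Fintype ι]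
    {k : ℕ} {g : Ω → ι → ℝ}
    (hg : Measurable[pastInfo μ w k] g) (hg2 : MemLp g 2 μ) :
    MemLp (fun ω => w k ω • g ω) 2 μ := by
  refine MemLp.of_eval fun i => ?_
  have hgi : Measurable[pastInfo μ w k] fun ω => g ω i := (measurable_pi_apply i).comp hg
  have hgi2 : MemLp (fun ω => g ω i) 2 μ := hg2.eval i
  have h : IndepFun (fun ω => w k ω ^ 2) (fun ω => g ω i ^ 2) μ :=
    (hw.indepFun hgi).comp (φ := fun x => x ^ 2) (ψ := fun x => x ^ 2) (by fun_prop)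
      (by fun_prop)
  have hint := h.integrable_mul (hw.memLp k).integrable_sq hgi2.integrable_sq
  refine (memLp_two_iff_integrable_sq ?_).2 ?_
  · exact (hw.memLp k).1.mul hgi2.1
  · refine hint.congr (.of_forall fun ω => ?_)
    simp [mul_pow]

/-- Conditioning at level k pulls g out and leaves the mean of the noise, which is zero; the tower
property then descends to level j. -/
theorem condExp_smul_eq_zero (hw : IsWhiteNoise μ w s) [IsProbabilityMeasure μ]
    {ι : Type*} [Fintype ι] {j k : ℕ} (hjk : j ≤ k) {g : Ω → ι → ℝ}
    (hg : Measurable[pastInfo μ w k] g) (hg2 : MemLp g 2 μ) :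
    μ[fun ω => w k ω • g ω | pastInfo μ w j] =ᵐ[μ] 0 := by
  have hint : Integrable (fun ω => w k ω • g ω) μ :=
    (hw.memLp_smul hg hg2).integrable (by norm_num)
  have h1 : μ[fun ω => w k ω • g ω | pastInfo μ w k] =ᵐ[μ] 0 := by
    have h2 := condExp_smul_of_aestronglyMeasurable_right (f := w k)
      (μ := μ) ((hw.memLp k).integrable (by norm_num)) hint
      hg.stronglyMeasurable.aestronglyMeasurable
    have h3 := condExp_indep_eq (hw.measurable k).comap_le (pastInfo_le k)
      (comap_measurable (w k)).stronglyMeasurable (hw.indep_pastInfo k)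
    refine h2.trans ?_
    filter_upwards [h3] with ω h3
    simp [h3, hw.mean k]
  refine (condExp_condExp_of_le (pastInfo_mono hjk) (pastInfo_le k)).symm.trans ?_
  refine (condExp_congr_ae h1).trans ?_
  simp

end IsWhiteNoise

end Noise

/-! ### Mean bilinear forms -/

/-- `E[aᵀ M b]`. -/
noncomputable def meanForm {Ω ι κ : Type*} [Fintype ι] [Fintype κ] [MeasurableSpace Ω]
    (μ : Measure Ω) (M : Matrix ι κ ℝ) (a : Ω → ι → ℝ) (b : Ω → κ → ℝ) : ℝ :=
  ∫ ω, a ω ⬝ᵥ M *ᵥ b ω ∂μ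

section MeanForm

theorem Measurable.mulVec_left {Ω ι κ : Type*} [Fintype ι] [Fintype κ] {m : MeasurableSpace Ω}
    {a : Ω → κ → ℝ} (ha : Measurable[m] a)
    (M : Matrix ι κ ℝ) : Measurable[m] (fun ω => M *ᵥ a ω) := by
  have : Measurable fun x : κ → ℝ => M *ᵥ x :=
    Continuous.measurable (by unfold mulVec dotProduct; fun_prop)
  exact this.comp ha

theorem Measurable.form {Ω ι κ : Type*} [Fintype ι] [Fintype κ] {m : MeasurableSpace Ω}
    {a : Ω → ι → ℝ} {b : Ω → κ → ℝ}
    (ha : Measurable[m] a) (hb : Measurable[m] b) (M : Matrix ι κ ℝ) :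
    Measurable[m] (fun ω => a ω ⬝ᵥ M *ᵥ b ω) := by
  have : Measurable fun x : (ι → ℝ) × (κ → ℝ) => x.1 ⬝ᵥ M *ᵥ x.2 :=
    Continuous.measurable (by unfold mulVec dotProduct; fun_prop)
  exact this.comp (ha.prodMk hb)


variable {Ω ι κ ι' κ' : Type*} [Fintype ι] [Fintype κ] [Fintype ι'] [Fintype κ']
  [mΩ : MeasurableSpace Ω] {μ : Measure Ω}

theorem MeasureTheory.MemLp.mulVec_left {a : Ω → κ → ℝ} (ha : MemLp a 2 μ) (M : Matrix ι κ ℝ) :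
    MemLp (fun ω => M *ᵥ a ω) 2 μ := by
  refine MemLp.of_eval fun i => ?_
  simp only [mulVec, dotProduct]
  exact memLp_finsetSum _ fun j _ => (ha.eval j).const_mul _

theorem MeasureTheory.MemLp.integrable_dotProduct {a b : Ω → ι → ℝ} (ha : MemLp a 2 μ)
    (hb : MemLp b 2 μ) : Integrable (fun ω => a ω ⬝ᵥ b ω) μ := by
  simp only [dotProduct]
  exact integrable_finsetSum _ fun j _ => (ha.eval j).integrable_mul (hb.eval j)

theorem MeasureTheory.MemLp.integrable_form {a : Ω → ι → ℝ} {b : Ω → κ → ℝ} (ha : MemLp a 2 μ)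
    (hb : MemLp b 2 μ) (M : Matrix ι κ ℝ) : Integrable (fun ω => a ω ⬝ᵥ M *ᵥ b ω) μ :=
  ha.integrable_dotProduct (hb.mulVec_left M)

theorem meanForm_congr {M : Matrix ι κ ℝ} {a a' : Ω → ι → ℝ} {b b' : Ω → κ → ℝ}
    (ha : a =ᵐ[μ] a') (hb : b =ᵐ[μ] b') : meanForm μ M a b = meanForm μ M a' b' :=
  integral_congr_ae (by filter_upwards [ha, hb] with ω h1 h2; rw [h1, h2])

theorem meanForm_transpose (M : Matrix ι κ ℝ) (a : Ω → ι → ℝ) (b : Ω → κ → ℝ) :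
    meanForm μ M a b = meanForm μ Mᵀ b a :=
  integral_congr_ae (.of_forall fun _ => dotProduct_mulVec_transpose _ _ _)

theorem meanForm_mulVec (P : Matrix ι ι' ℝ) (M : Matrix ι κ ℝ) (P' : Matrix κ κ' ℝ)
    (a : Ω → ι' → ℝ) (b : Ω → κ' → ℝ) :
    meanForm μ M (fun ω => P *ᵥ a ω) (fun ω => P' *ᵥ b ω) = meanForm μ (Pᵀ * M * P') a b :=
  integral_congr_ae (.of_forall fun _ => mulVec_dotProduct_mulVec _ _ _ _ _)

theorem meanForm_add_left {M : Matrix ι κ ℝ} {a a' : Ω → ι → ℝ} {b : Ω → κ → ℝ}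
    (ha : MemLp a 2 μ) (ha' : MemLp a' 2 μ) (hb : MemLp b 2 μ) :
    meanForm μ M (fun ω => a ω + a' ω) b = meanForm μ M a b + meanForm μ M a' b := by
  simp only [meanForm, add_dotProduct]
  exact integral_add (ha.integrable_form hb M) (ha'.integrable_form hb M)

theorem meanForm_add_right {M : Matrix ι κ ℝ} {a : Ω → ι → ℝ} {b b' : Ω → κ → ℝ}
    (ha : MemLp a 2 μ) (hb : MemLp b 2 μ) (hb' : MemLp b' 2 μ) :
    meanForm μ M a (fun ω => b ω + b' ω) = meanForm μ M a b + meanForm μ M a b' := by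
  simp only [meanForm, mulVec_add, dotProduct_add]
  exact integral_add (ha.integrable_form hb M) (ha.integrable_form hb' M)

theorem meanForm_add_matrix {M M' : Matrix ι κ ℝ} {a : Ω → ι → ℝ} {b : Ω → κ → ℝ}
    (ha : MemLp a 2 μ) (hb : MemLp b 2 μ) :
    meanForm μ (M + M') a b = meanForm μ M a b + meanForm μ M' a b := by
  simp only [meanForm, add_mulVec, dotProduct_add]
  exact integral_add (ha.integrable_form hb M) (ha.integrable_form hb M')

theorem meanForm_sub_matrix {M M' : Matrix ι κ ℝ} {a : Ω → ι → ℝ} {b : Ω → κ → ℝ}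
    (ha : MemLp a 2 μ) (hb : MemLp b 2 μ) :
    meanForm μ (M - M') a b = meanForm μ M a b - meanForm μ M' a b := by
  simp only [meanForm, sub_mulVec, dotProduct_sub]
  exact integral_sub (ha.integrable_form hb M) (ha.integrable_form hb M')

theorem meanForm_smul_matrix (c : ℝ) (M : Matrix ι κ ℝ) (a : Ω → ι → ℝ) (b : Ω → κ → ℝ) :
    meanForm μ (c • M) a b = c * meanForm μ M a b := by
  simp only [meanForm, smul_mulVec, dotProduct_smul, smul_eq_mul]
  exact integral_const_mul _ _

theorem meanForm_zero_matrix (a : Ω → ι → ℝ) (b : Ω → κ → ℝ) :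
    meanForm μ (0 : Matrix ι κ ℝ) a b = 0 := by
  simp [meanForm]

theorem meanForm_sum_matrix {σ : Type*} (t : Finset σ) (M : σ → Matrix ι κ ℝ) {a : Ω → ι → ℝ}
    {b : Ω → κ → ℝ} (ha : MemLp a 2 μ) (hb : MemLp b 2 μ) :
    meanForm μ (∑ i ∈ t, M i) a b = ∑ i ∈ t, meanForm μ (M i) a b := by
  classical
  induction t using Finset.induction_on with
  | empty => simp [meanForm_zero_matrix]
  | insert i t hi ih =>
    rw [Finset.sum_insert hi, Finset.sum_insert hi, meanForm_add_matrix ha hb, ih]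

end MeanForm

/-- `E[aᵀ M b] = E[aᵀ M E[b | m]]` if `a` is `m`-measurable. -/
theorem meanForm_condExp {Ω ι κ : Type*} [Fintype ι] [Fintype κ] {m mΩ : MeasurableSpace Ω}
    {μ : Measure Ω} [IsProbabilityMeasure μ] (hm : m ≤ mΩ)
    (M : Matrix ι κ ℝ) {a : Ω → ι → ℝ} {b : Ω → κ → ℝ}
    (ham : Measurable[m] a) (ha : MemLp a 2 μ) (hb : MemLp b 2 μ) :
    meanForm μ M a b = meanForm μ M a (μ[b | m]) := by
  let T : (ι → ℝ) →L[ℝ] (κ → ℝ) →L[ℝ] ℝ := LinearMap.toContinuousLinearMap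
    (LinearMap.toContinuousLinearMap.toLinearMap ∘ₗ
      LinearMap.mk₂ ℝ (fun x y => x ⬝ᵥ M *ᵥ y) (by simp [add_dotProduct])
        (by simp) (by simp [mulVec_add]) (by simp [mulVec_smul]))
  have hT : ∀ x y, T x y = x ⬝ᵥ M *ᵥ y := fun x y => rfl
  have h := condExp_bilin_of_stronglyMeasurable_left (μ := μ) T ham.stronglyMeasurable
    (by simpa only [hT] using ha.integrable_form hb M) (hb.integrable (by norm_num))
  rw [meanForm, meanForm, ← integral_condExp hm]
  exact integral_congr_ae h

/-! ### Conditional means of random vectors. -/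

section ConditionalMean

variable {Ω ι κ : Type*} [Fintype ι] [Fintype κ] [mΩ : MeasurableSpace Ω] {μ : Measure Ω}

theorem condExp_mulVec (M : Matrix ι κ ℝ) {x : Ω → κ → ℝ} (hx : Integrable x μ)
    (m : MeasurableSpace Ω) :
    μ[fun ω => M *ᵥ x ω | m] =ᵐ[μ] fun ω => M *ᵥ (μ[x | m]) ω :=
  (ContinuousLinearMap.comp_condExp_comm (m := m) hx
    (LinearMap.toContinuousLinearMap M.mulVecLin)).symm

theorem measurable_condExp_pi (m : MeasurableSpace Ω) (x : Ω → κ → ℝ) :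
    Measurable[m] (μ[x | m]) :=
  stronglyMeasurable_condExp.measurable

theorem MeasureTheory.MemLp.condExp_two {x : Ω → κ → ℝ} (hx : MemLp x 2 μ)
    (m : MeasurableSpace Ω) : MemLp (μ[x | m]) 2 μ :=
  hx.condExp (by norm_num)

end ConditionalMean

/-- Conditional expectation is an orthogonal projection: transposing puts the measurable factor
first, and `meanForm_condExp` then projects the other one. -/
theorem meanForm_condExp_self {Ω ι : Type*} [Fintype ι] {m mΩ : MeasurableSpace Ω}
    {μ : Measure Ω} [IsProbabilityMeasure μ] (hm : m ≤ mΩ)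
    (M : Matrix ι ι ℝ) {x : Ω → ι → ℝ} (hx : MemLp x 2 μ) :
    meanForm μ M x (μ[x | m]) = meanForm μ M (μ[x | m]) (μ[x | m]) := by
  rw [meanForm_transpose, meanForm_condExp hm _ (measurable_condExp_pi m x) (hx.condExp_two m) hx,
    ← meanForm_transpose]

namespace DelayLQ

variable {n p m : ℕ} {S : DelayLQ n p m} {Ω : Type*} [MeasurableSpace Ω] {μ : Measure Ω}
  [IsProbabilityMeasure μ] {w : ℕ → Ω → ℝ}

/-! ### One step of the dynamics -/

variable (S w) in
/-- The state that follows `x` at time `t` if the input `v` acts. -/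
noncomputable def next (t : ℕ) (x : Ω → Fin n → ℝ) (v : Ω → Fin p → ℝ) (ω : Ω) : Fin n → ℝ :=
  (S.A + w t ω • S.Abar) *ᵥ x ω + (S.B + w t ω • S.Bbar) *ᵥ v ω

theorem state_succ (u : ℕ → Ω → Fin p → ℝ) (t : ℕ) :
    S.state w u (t + 1) = S.next w t (S.state w u t) (S.input u t) := rfl

theorem next_eq (t : ℕ) (x : Ω → Fin n → ℝ) (v : Ω → Fin p → ℝ) :
    S.next w t x v = fun ω => (S.A *ᵥ x ω + S.B *ᵥ v ω)
      + w t ω • (S.Abar *ᵥ x ω + S.Bbar *ᵥ v ω) := by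
  funext ω
  simp only [next, add_mulVec, smul_mulVec, smul_add]
  abel

section Step

variable {t : ℕ} {x : Ω → Fin n → ℝ} {v : Ω → Fin p → ℝ}

theorem memLp_affine (C : Matrix (Fin n) (Fin n) ℝ) (D : Matrix (Fin n) (Fin p) ℝ)
    (hx : MemLp x 2 μ) (hv : MemLp v 2 μ) : MemLp (fun ω => C *ᵥ x ω + D *ᵥ v ω) 2 μ :=
  (hx.mulVec_left C).add (hv.mulVec_left D)

theorem measurable_affine {m' : MeasurableSpace Ω} (C : Matrix (Fin n) (Fin n) ℝ)
    (D : Matrix (Fin n) (Fin p) ℝ) (hx : Measurable[m'] x) (hv : Measurable[m'] v) :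
    Measurable[m'] (fun ω => C *ᵥ x ω + D *ᵥ v ω) :=
  (hx.mulVec_left C).add (hv.mulVec_left D)

theorem measurable_next (hw : IsWhiteNoise μ w S.sigma) (hxm : Measurable[pastInfo μ w t] x)
    (hvm : Measurable[pastInfo μ w t] v) : Measurable[pastInfo μ w (t + 1)] (S.next w t x v) := by
  have hle := pastInfo_mono (μ := μ) (w := w) (Nat.le_succ t)
  have hxm' := hxm.mono hle le_rfl
  have hvm' := hvm.mono hle le_rfl
  rw [next_eq]
  exact (measurable_affine S.A S.B hxm' hvm').add
    ((hw.measurable_pastInfo t).smul (measurable_affine S.Abar S.Bbar hxm' hvm'))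

theorem memLp_next (hw : IsWhiteNoise μ w S.sigma) (hxm : Measurable[pastInfo μ w t] x)
    (hx : MemLp x 2 μ) (hvm : Measurable[pastInfo μ w t] v) (hv : MemLp v 2 μ) :
    MemLp (S.next w t x v) 2 μ := by
  rw [next_eq]
  exact (memLp_affine S.A S.B hx hv).add
    (hw.memLp_smul (measurable_affine S.Abar S.Bbar hxm hvm) (memLp_affine S.Abar S.Bbar hx hv))

theorem meanForm_affine (N : Matrix (Fin n) (Fin n) ℝ) (C : Matrix (Fin n) (Fin n) ℝ)
    (D : Matrix (Fin n) (Fin p) ℝ) (hN : Nᵀ = N) (hx : MemLp x 2 μ) (hv : MemLp v 2 μ) :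
    meanForm μ N (fun ω => C *ᵥ x ω + D *ᵥ v ω) (fun ω => C *ᵥ x ω + D *ᵥ v ω)
      = meanForm μ (Cᵀ * N * C) x x + meanForm μ (Dᵀ * N * D) v v
        + 2 * meanForm μ (Dᵀ * N * C) v x := by
  have hC := hx.mulVec_left C
  have hD := hv.mulVec_left D
  have hxv : meanForm μ (Cᵀ * N * D) x v = meanForm μ (Dᵀ * N * C) v x := by
    rw [meanForm_transpose]
    simp [transpose_mul, hN, Matrix.mul_assoc]
  have hCD : MemLp (fun ω => C *ᵥ x ω + D *ᵥ v ω) 2 μ := hC.add hD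
  rw [meanForm_add_left hC hD hCD, meanForm_add_right hC hC hD,
    meanForm_add_right hD hC hD, meanForm_mulVec, meanForm_mulVec, meanForm_mulVec,
    meanForm_mulVec, hxv]
  ring

/-- Independence and zero mean remove the terms linear in the noise, and its variance multiplies the
quadratic one. -/
theorem meanForm_next (hw : IsWhiteNoise μ w S.sigma) (N : Matrix (Fin n) (Fin n) ℝ)
    (hN : Nᵀ = N) (hxm : Measurable[pastInfo μ w t] x) (hx : MemLp x 2 μ)
    (hvm : Measurable[pastInfo μ w t] v) (hv : MemLp v 2 μ) :
    meanForm μ N (S.next w t x v) (S.next w t x v)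
      = meanForm μ (S.Aᵀ * N * S.A + S.sigma ^ 2 • (S.Abarᵀ * N * S.Abar)) x x
        + meanForm μ (S.Bᵀ * N * S.B + S.sigma ^ 2 • (S.Bbarᵀ * N * S.Bbar)) v v
        + 2 * meanForm μ (S.Bᵀ * N * S.A + S.sigma ^ 2 • (S.Bbarᵀ * N * S.Abar)) v x := by
  set y := fun ω => S.A *ᵥ x ω + S.B *ᵥ v ω with hy
  set z := fun ω => S.Abar *ᵥ x ω + S.Bbar *ᵥ v ω with hz
  have hy2 : MemLp y 2 μ := memLp_affine _ _ hx hv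
  have hz2 : MemLp z 2 μ := memLp_affine _ _ hx hv
  have hym : Measurable[pastInfo μ w t] y := measurable_affine _ _ hxm hvm
  have hzm : Measurable[pastInfo μ w t] z := measurable_affine _ _ hxm hvm
  have hwz : MemLp (fun ω => w t ω • z ω) 2 μ := hw.memLp_smul hzm hz2
  have h1 : meanForm μ N y (fun ω => w t ω • z ω) = 0 := by
    simp only [meanForm, mulVec_smul, dotProduct_smul, smul_eq_mul]
    exact hw.integral_mul_eq_zero (hym.form hzm N)
  have h2 : meanForm μ N (fun ω => w t ω • z ω) y = 0 := by
    simp only [meanForm, smul_dotProduct, smul_eq_mul]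
    exact hw.integral_mul_eq_zero (hzm.form hym N)
  have h3 : meanForm μ N (fun ω => w t ω • z ω) (fun ω => w t ω • z ω)
      = S.sigma ^ 2 * meanForm μ N z z := by
    rw [meanForm, meanForm, ← hw.integral_sq_mul (hzm.form hzm N)]
    congr 1
    funext ω
    simp only [mulVec_smul, dotProduct_smul, smul_dotProduct, smul_eq_mul]
    ring
  have h4 : S.next w t x v = fun ω => y ω + w t ω • z ω := next_eq _ _ _
  have hyz : MemLp (fun ω => y ω + w t ω • z ω) 2 μ := hy2.add hwz
  rw [h4, meanForm_add_left hy2 hwz hyz, meanForm_add_right hy2 hy2 hwz,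
    meanForm_add_right hwz hy2 hwz, h1, h2, h3, hy, hz, meanForm_affine N _ _ hN hx hv,
    meanForm_affine N _ _ hN hx hv, meanForm_add_matrix hx hx, meanForm_add_matrix hv hv,
    meanForm_add_matrix hv hx, meanForm_smul_matrix, meanForm_smul_matrix, meanForm_smul_matrix]
  ring

theorem condExp_next (hw : IsWhiteNoise μ w S.sigma) {j : ℕ} (hj : j ≤ t)
    (hxm : Measurable[pastInfo μ w t] x) (hx : MemLp x 2 μ)
    (hvm : Measurable[pastInfo μ w j] v) (hv : MemLp v 2 μ) :
    μ[S.next w t x v | pastInfo μ w j]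
      =ᵐ[μ] fun ω => S.A *ᵥ (μ[x | pastInfo μ w j]) ω + S.B *ᵥ v ω := by
  have hvm' := hvm.mono (pastInfo_mono hj) le_rfl
  have h1 := (hx.mulVec_left S.A).integrable (q := 2) (by norm_num)
  have h2 := (hv.mulVec_left S.B).integrable (q := 2) (by norm_num)
  have hz2 := memLp_affine S.Abar S.Bbar hx hv
  have hzm := measurable_affine S.Abar S.Bbar hxm hvm'
  have h3 := (hw.memLp_smul hzm hz2).integrable (by norm_num)
  have e1 : μ[S.next w t x v | pastInfo μ w j] =ᵐ[μ]
      μ[fun ω => S.A *ᵥ x ω + S.B *ᵥ v ω | pastInfo μ w j]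
      + μ[fun ω => w t ω • (S.Abar *ᵥ x ω + S.Bbar *ᵥ v ω) | pastInfo μ w j] := by
    rw [next_eq]
    exact condExp_add (h1.add h2) h3 _
  have e2 : μ[fun ω => S.A *ᵥ x ω + S.B *ᵥ v ω | pastInfo μ w j] =ᵐ[μ]
      μ[fun ω => S.A *ᵥ x ω | pastInfo μ w j] + μ[fun ω => S.B *ᵥ v ω | pastInfo μ w j] :=
    condExp_add h1 h2 _
  have e3 : μ[fun ω => S.B *ᵥ v ω | pastInfo μ w j] = fun ω => S.B *ᵥ v ω :=
    condExp_of_stronglyMeasurable (pastInfo_le j) (hvm.mulVec_left S.B).stronglyMeasurable h2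
  filter_upwards [e1, e2, condExp_mulVec S.A (hx.integrable (by norm_num)) (pastInfo μ w j),
    hw.condExp_smul_eq_zero hj hzm hz2] with ω g1 g2 g3 g4
  rw [g1, Pi.add_apply, g2, Pi.add_apply, g3, g4, e3]
  simp

/-- The prediction contains no noise, so no `sigma` appears. As v is known at level j, the
prediction of x in the cross term can be replaced by x again. -/
theorem meanForm_next_condExp (hw : IsWhiteNoise μ w S.sigma) {j : ℕ} (hj : j ≤ t)
    (N : Matrix (Fin n) (Fin n) ℝ) (hN : Nᵀ = N)
    (hxm : Measurable[pastInfo μ w t] x) (hx : MemLp x 2 μ)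
    (hvm : Measurable[pastInfo μ w j] v) (hv : MemLp v 2 μ) :
    meanForm μ N (S.next w t x v) (μ[S.next w t x v | pastInfo μ w j])
      = meanForm μ (S.Aᵀ * N * S.A) x (μ[x | pastInfo μ w j]) + meanForm μ (S.Bᵀ * N * S.B) v v
        + 2 * meanForm μ (S.Bᵀ * N * S.A) v x := by
  have hvm' := hvm.mono (pastInfo_mono hj) le_rfl
  have h := condExp_next hw hj hxm hx hvm hv
  rw [meanForm_condExp_self (pastInfo_le j) _ (memLp_next hw hxm hx hvm' hv),
    meanForm_congr h h, meanForm_affine N _ _ hN (hx.condExp_two _) hv,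
    ← meanForm_condExp_self (pastInfo_le j) _ hx,
    ← meanForm_condExp (pastInfo_le j) _ hvm hv hx]

end Step

/-! ### The optimal cost-to-go -/

variable (S μ w) in
/-- `E[xᵀ X_t x - ∑_{i<d} xᵀ (Aᵀ)^i L_{t+i} A^i E[x | F_{t-d+i-1}]]`. -/
noncomputable def costToGo (l : Fin m → ℝ) (t : ℕ) (x : Ω → Fin n → ℝ) : ℝ :=
  meanForm μ (S.X l t) x x - ∑ i ∈ Finset.range S.d,
    meanForm μ (S.Aᵀ ^ i * S.L l (t + i) * S.A ^ i) x (μ[x | pastInfo μ w (t - S.d + i)])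

variable (S μ w) in
/-- The loss caused at time `t` by the input `v` instead of the feedback law. -/
noncomputable def excess (l : Fin m → ℝ) (t : ℕ) (x : Ω → Fin n → ℝ) (v : Ω → Fin p → ℝ) : ℝ :=
  meanForm μ (S.Upsilon l t)
    (fun ω => v ω + ((S.Upsilon l t)⁻¹ * S.M l t) *ᵥ (μ[x | pastInfo μ w (t - S.d)]) ω)
    (fun ω => v ω + ((S.Upsilon l t)⁻¹ * S.M l t) *ᵥ (μ[x | pastInfo μ w (t - S.d)]) ω)

theorem conj_pow_transpose {N : Matrix (Fin n) (Fin n) ℝ} (hN : Nᵀ = N) (i : ℕ) :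
    (S.Aᵀ ^ i * N * S.A ^ i)ᵀ = S.Aᵀ ^ i * N * S.A ^ i := by
  simp [transpose_mul, transpose_pow, hN, Matrix.mul_assoc]

theorem conj_pow_succ (N : Matrix (Fin n) (Fin n) ℝ) (i : ℕ) :
    S.Aᵀ * (S.Aᵀ ^ i * N * S.A ^ i) * S.A = S.Aᵀ ^ (i + 1) * N * S.A ^ (i + 1) := by
  rw [pow_succ' S.Aᵀ, pow_succ S.A]
  simp only [Matrix.mul_assoc]

theorem meanForm_sub_sum {ι κ ι' κ' : Type*} [Fintype ι] [Fintype κ] [Fintype ι'] [Fintype κ']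
    (P : Matrix ι ι' ℝ) (X : Matrix ι κ ℝ) (P' : Matrix κ κ' ℝ)
    (s : Finset ℕ) (K : ℕ → Matrix ι κ ℝ) {a : Ω → ι' → ℝ} {b : Ω → κ' → ℝ}
    (ha : MemLp a 2 μ) (hb : MemLp b 2 μ) :
    meanForm μ (Pᵀ * (X - ∑ i ∈ s, K i) * P') a b
      = meanForm μ (Pᵀ * X * P') a b - ∑ i ∈ s, meanForm μ (Pᵀ * K i * P') a b := by
  rw [Matrix.mul_sub, Matrix.sub_mul, meanForm_sub_matrix ha hb, Matrix.mul_sum, Matrix.sum_mul,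
    meanForm_sum_matrix s _ ha hb]

theorem costToGo_eq (hw : IsWhiteNoise μ w S.sigma) (hW : S.PositiveWeights) {l : Fin m → ℝ}
    (hl : 0 ≤ l) {t : ℕ} (hdt : S.d ≤ t) (ht : t ≤ S.N) {x : Ω → Fin n → ℝ} {v : Ω → Fin p → ℝ}
    (hxm : Measurable[pastInfo μ w t] x) (hx : MemLp x 2 μ)
    (hvm : Measurable[pastInfo μ w (t - S.d)] v) (hv : MemLp v 2 μ) :
    meanForm μ (S.Qof l) x x + meanForm μ (S.Rof l) v v
        + S.costToGo μ w l (t + 1) (S.next w t x v)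
      = S.costToGo μ w l t x + S.excess μ w l t x v := by
  have hvt : Measurable[pastInfo μ w t] v := hvm.mono (pastInfo_mono (Nat.sub_le _ _)) le_rfl
  have hXs : (S.X l (t + 1))ᵀ = S.X l (t + 1) := (hW.X_posSemidef hl _).transpose_eq
  set K : ℕ → Matrix (Fin n) (Fin n) ℝ := fun i => S.Aᵀ ^ i * S.L l (t + 1 + i) * S.A ^ i with hK
  have hKs : ∀ i, (K i)ᵀ = K i := fun i =>
    conj_pow_transpose (hW.L_posSemidef hl _).transpose_eq i
  -- the next cost-to-go
  have h1 : S.costToGo μ w l (t + 1) (S.next w t x v)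
      = meanForm μ (S.Aᵀ * S.X l (t + 1) * S.A
          + S.sigma ^ 2 • (S.Abarᵀ * S.X l (t + 1) * S.Abar)) x x
        + meanForm μ (S.Bᵀ * S.X l (t + 1) * S.B
          + S.sigma ^ 2 • (S.Bbarᵀ * S.X l (t + 1) * S.Bbar)) v v
        + 2 * meanForm μ (S.Bᵀ * S.X l (t + 1) * S.A
          + S.sigma ^ 2 • (S.Bbarᵀ * S.X l (t + 1) * S.Abar)) v x
        - ∑ i ∈ Finset.range S.d, (meanForm μ (S.Aᵀ * K i * S.A) x
            (μ[x | pastInfo μ w (t - S.d + (i + 1))])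
          + meanForm μ (S.Bᵀ * K i * S.B) v v + 2 * meanForm μ (S.Bᵀ * K i * S.A) v x) := by
    rw [costToGo, meanForm_next hw _ hXs hxm hx hvt hv]
    congr 1
    refine Finset.sum_congr rfl fun i hi => ?_
    have hi' := Finset.mem_range.1 hi
    -- Level i as seen from time t + 1 is level i + 1 as seen from time t. It does not exceed t
    -- because i < d, so the noise at time t is still unknown there.
    have e : t + 1 - S.d + i = t - S.d + (i + 1) := by omega
    rw [e, meanForm_next_condExp hw (by omega) (K i) (hKs i) hxm hx
      (hvm.mono (pastInfo_mono (by omega)) le_rfl) hv]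
  -- The recursion for X covers times up to N only. At t = N both matrices equal F(l) and every `K
  -- i` vanishes.
  have hZ : S.Z l (t + 1) = S.X l (t + 1) - ∑ i ∈ Finset.range S.d, K i := by
    rcases Nat.lt_or_ge t S.N with h | h
    · rw [S.X_step l (t + 1) h, add_sub_cancel_right]
    · obtain rfl : t = S.N := le_antisymm ht h
      have : ∀ i, K i = 0 := fun i => by
        simp [hK, L, show ¬ (S.N + 1 + i ≤ S.N) by omega]
      simp [this, Z_terminal, X_terminal]
  -- the current cost-to-go
  set a : ℕ → ℝ := fun i => meanForm μ (S.Aᵀ ^ i * S.L l (t + i) * S.A ^ i) x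
    (μ[x | pastInfo μ w (t - S.d + i)]) with ha
  set b : ℕ → ℝ := fun i => meanForm μ (S.Aᵀ ^ i * S.L l (t + i) * S.A ^ i) x x with hb
  have hKA : ∀ i, S.Aᵀ * K i * S.A = S.Aᵀ ^ (i + 1) * S.L l (t + (i + 1)) * S.A ^ (i + 1) :=
    fun i => by rw [hK, conj_pow_succ, show t + 1 + i = t + (i + 1) by omega]
  -- At index d the information is that of time t itself, where x is measurable and its prediction
  -- is exact.
  have had : a S.d = b S.d := by
    simp only [ha, hb, Nat.sub_add_cancel hdt]
    rw [condExp_of_stronglyMeasurable (pastInfo_le t) hxm.stronglyMeasurable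
      (hx.integrable (by norm_num))]
  have hsa : ∑ i ∈ Finset.range S.d, a (i + 1) = ∑ i ∈ Finset.range S.d, a i + a S.d - a 0 := by
    rw [← Finset.sum_range_succ, Finset.sum_range_succ', add_sub_cancel_right]
  have hsb : ∑ i ∈ Finset.range S.d, b (i + 1) = ∑ i ∈ Finset.range S.d, b i + b S.d - b 0 := by
    rw [← Finset.sum_range_succ, Finset.sum_range_succ', add_sub_cancel_right]
  have hb0 : b 0 = meanForm μ (S.L l t) x x := by simp [hb]
  have h2 : S.costToGo μ w l t x = meanForm μ (S.Aᵀ * S.Z l (t + 1) * S.A) x x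
      + meanForm μ (S.sigma ^ 2 • (S.Abarᵀ * S.X l (t + 1) * S.Abar)) x x
      + meanForm μ (S.Qof l) x x - b 0 + ∑ i ∈ Finset.range S.d, b i
      - ∑ i ∈ Finset.range S.d, a i := by
    rw [costToGo, S.X_step l t ht, S.Z_step l t ht, meanForm_add_matrix hx hx,
      meanForm_sub_matrix hx hx, meanForm_add_matrix hx hx, meanForm_add_matrix hx hx,
      meanForm_sum_matrix _ _ hx hx, hb0]
  -- the loss
  have h3 : S.excess μ w l t x v = meanForm μ (S.Upsilon l t) v v + 2 * meanForm μ (S.M l t) v x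
      + a 0 := by
    have hx' := hx.condExp_two (pastInfo μ w (t - S.d))
    have ha0 : a 0 = meanForm μ (S.L l t) (μ[x | pastInfo μ w (t - S.d)])
        (μ[x | pastInfo μ w (t - S.d)]) := by
      rw [← meanForm_condExp_self (pastInfo_le _) _ hx]
      simp [ha]
    -- The input is known at level t - d, so the cross term sees x only through its prediction, and
    -- the square can be completed pointwise.
    rw [ha0, meanForm_condExp (pastInfo_le _) (S.M l t) hvm hv hx]
    simp only [excess, meanForm]
    have hint : Integrable (fun ω => v ω ⬝ᵥ S.Upsilon l t *ᵥ v ω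
        + 2 * (v ω ⬝ᵥ S.M l t *ᵥ (μ[x | pastInfo μ w (t - S.d)]) ω)) μ :=
      (hv.integrable_form hv _).add ((hv.integrable_form hx' _).const_mul 2)
    rw [← integral_const_mul, ← integral_add (hv.integrable_form hv _)
      ((hv.integrable_form hx' _).const_mul 2), ← integral_add hint (hx'.integrable_form hx' _)]
    refine integral_congr_ae (.of_forall fun ω => ?_)
    have := complete_square (hW.Upsilon_posDef hl t) (S.M l t) (v ω)
      ((μ[x | pastInfo μ w (t - S.d)]) ω)
    simp only [L, ht, if_true]
    linarith
  rw [h1, h2, h3, Upsilon, M, hZ]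
  simp only [hKA, Finset.sum_add_distrib, ← Finset.mul_sum, meanForm_add_matrix hx hx,
    meanForm_add_matrix hv hv, meanForm_add_matrix hv hx, meanForm_sub_sum _ _ _ _ _ hx hx,
    meanForm_sub_sum _ _ _ _ _ hv hv, meanForm_sub_sum _ _ _ _ _ hv hx]
  -- Only the shifted sums need care. The exact forms `b` collapse to their end term at d, which
  -- cancels `a S.d`; the other end term `a 0` is the one supplied by the completed square.
  change _ + _ + (_ - (∑ i ∈ Finset.range S.d, a (i + 1) + _ + _))
    = _ - ∑ i ∈ Finset.range S.d, b (i + 1) + _ + _ - _ + _ - _ + _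
  rw [hsa, hsb, had]
  ring

end DelayLQ

namespace DelayLQ

variable {n p m : ℕ} {S : DelayLQ n p m} {Ω : Type*} [MeasurableSpace Ω] {μ : Measure Ω}
  [IsProbabilityMeasure μ] {w : ℕ → Ω → ℝ} {u : ℕ → Ω → Fin p → ℝ}

/-! ### Trajectories -/

theorem input_of_le (u : ℕ → Ω → Fin p → ℝ) {t : ℕ} (ht : S.d ≤ t) :
    S.input u t = u (t - S.d) := by
  funext ω
  simp [input, Nat.not_lt.2 ht]

theorem input_regular {t : ℕ} (hu : S.d ≤ t →
      Measurable[pastInfo μ w (t - S.d)] (u (t - S.d)) ∧ MemLp (u (t - S.d)) 2 μ) :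
    Measurable[pastInfo μ w (t - S.d)] (S.input u t) ∧ MemLp (S.input u t) 2 μ := by
  rcases Nat.lt_or_ge t S.d with h | h
  -- Here t - d truncates to 0; the given inputs are constants, hence measurable at every level.
  · have : S.input u t = fun _ => S.past ⟨t, h⟩ := by funext ω; simp [input, h]
    rw [this]
    exact ⟨measurable_const, memLp_const _⟩
  · rw [input_of_le u h]
    exact hu h

theorem state_regular (hw : IsWhiteNoise μ w S.sigma) {k : ℕ}
    (hu : ∀ j, j + S.d < k → Measurable[pastInfo μ w j] (u j) ∧ MemLp (u j) 2 μ) :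
    Measurable[pastInfo μ w k] (S.state w u k) ∧ MemLp (S.state w u k) 2 μ := by
  induction k with
  | zero =>
    have : S.state w u 0 = fun _ => S.x0 := rfl
    rw [this]
    exact ⟨measurable_const, memLp_const _⟩
  | succ k ih =>
    obtain ⟨hm, h2⟩ := ih fun j hj => hu j (by omega)
    obtain ⟨hvm, hv⟩ := input_regular (S := S) (μ := μ) (w := w) (u := u) (t := k)
      fun h => hu (k - S.d) (by omega)
    have hvm' := hvm.mono (pastInfo_mono (Nat.sub_le _ _)) le_rfl
    rw [state_succ]
    exact ⟨measurable_next hw hm hvm', memLp_next hw hm h2 hvm' hv⟩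

theorem state_congr (w : ℕ → Ω → ℝ) {u u' : ℕ → Ω → Fin p → ℝ} {k : ℕ}
    (h : ∀ j, j + S.d < k → u j = u' j) : S.state w u k = S.state w u' k := by
  induction k with
  | zero => rfl
  | succ k ih =>
    have h1 : S.input u k = S.input u' k := by
      rcases Nat.lt_or_ge k S.d with hk | hk
      · funext ω; simp [input, hk]
      · rw [input_of_le u hk, input_of_le u' hk, h _ (by omega)]
    rw [state_succ, state_succ, ih fun j hj => h j (by omega), h1]

namespace Admissible

theorem control (hu : S.Admissible μ w u) {t : ℕ} (ht : t ≤ S.N) (hd : S.d ≤ t) :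
    Measurable[pastInfo μ w (t - S.d)] (u (t - S.d)) ∧ MemLp (u (t - S.d)) 2 μ :=
  hu (t - S.d) (by omega)

theorem input (hu : S.Admissible μ w u) {t : ℕ} (ht : t ≤ S.N) :
    Measurable[pastInfo μ w (t - S.d)] (S.input u t) ∧ MemLp (S.input u t) 2 μ :=
  input_regular fun hd => hu.control ht hd

theorem state (hw : IsWhiteNoise μ w S.sigma) (hu : S.Admissible μ w u) {t : ℕ}
    (ht : t ≤ S.N + 1) :
    Measurable[pastInfo μ w t] (S.state w u t) ∧ MemLp (S.state w u t) 2 μ :=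
  state_regular hw fun j hj => hu j (by omega)

end Admissible

/-! ### The Lagrangian as optimal cost plus loss -/

theorem J_eq (hw : IsWhiteNoise μ w S.sigma) (hu : S.Admissible μ w u) (i : Fin (m + 1)) :
    S.J μ w i u = ∑ k ∈ Finset.range (S.N + 1), meanForm μ (S.Q i) (S.state w u k) (S.state w u k)
      + ∑ k ∈ Finset.Icc S.d S.N, meanForm μ (S.R i) (u (k - S.d)) (u (k - S.d))
      + meanForm μ (S.F i) (S.state w u (S.N + 1)) (S.state w u (S.N + 1)) := by
  have h1 : ∀ k ∈ Finset.range (S.N + 1),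
      Integrable (fun ω => S.state w u k ω ⬝ᵥ S.Q i *ᵥ S.state w u k ω) μ := fun k hk => by
    have := (hu.state hw (t := k) (by have := Finset.mem_range.1 hk; omega)).2
    exact this.integrable_form this _
  have h2 : ∀ k ∈ Finset.Icc S.d S.N,
      Integrable (fun ω => u (k - S.d) ω ⬝ᵥ S.R i *ᵥ u (k - S.d) ω) μ := fun k hk => by
    have hk' := Finset.mem_Icc.1 hk
    have := (hu.control hk'.2 hk'.1).2
    exact this.integrable_form this _
  have h3 : Integrable
      (fun ω => S.state w u (S.N + 1) ω ⬝ᵥ S.F i *ᵥ S.state w u (S.N + 1) ω) μ := by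
    have := (hu.state hw (t := S.N + 1) le_rfl).2
    exact this.integrable_form this _
  unfold J
  have h12 : Integrable (fun ω =>
      (∑ k ∈ Finset.range (S.N + 1), S.state w u k ω ⬝ᵥ S.Q i *ᵥ S.state w u k ω)
      + ∑ k ∈ Finset.Icc S.d S.N, u (k - S.d) ω ⬝ᵥ S.R i *ᵥ u (k - S.d) ω) μ :=
    (integrable_finsetSum _ h1).add (integrable_finsetSum _ h2)
  rw [integral_add h12 h3,
    integral_add (integrable_finsetSum _ h1) (integrable_finsetSum _ h2),
    integral_finsetSum _ h1, integral_finsetSum _ h2]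
  rfl

theorem meanForm_weight {ι : Type*} [Fintype ι] (P : Fin (m + 1) → Matrix ι ι ℝ) (l : Fin m → ℝ)
    {x : Ω → ι → ℝ} (hx : MemLp x 2 μ) :
    meanForm μ (P 0 + ∑ i, l i • P i.succ) x x
      = meanForm μ (P 0) x x + ∑ i, l i * meanForm μ (P i.succ) x x := by
  rw [meanForm_add_matrix hx hx, meanForm_sum_matrix _ _ hx hx]
  simp only [meanForm_smul_matrix]

theorem lagrangian_eq_sum (hw : IsWhiteNoise μ w S.sigma) (hu : S.Admissible μ w u)
    (l : Fin m → ℝ) :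
    S.lagrangian μ w l u
      = ∑ k ∈ Finset.range (S.N + 1), meanForm μ (S.Qof l) (S.state w u k) (S.state w u k)
      + ∑ k ∈ Finset.Icc S.d S.N, meanForm μ (S.Rof l) (u (k - S.d)) (u (k - S.d))
      + meanForm μ (S.Fof l) (S.state w u (S.N + 1)) (S.state w u (S.N + 1))
      - ∑ i, l i * S.c i := by
  have h1 : ∀ k ∈ Finset.range (S.N + 1), meanForm μ (S.Qof l) (S.state w u k) (S.state w u k)
      = meanForm μ (S.Q 0) (S.state w u k) (S.state w u k)
        + ∑ i, l i * meanForm μ (S.Q i.succ) (S.state w u k) (S.state w u k) := fun k hk =>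
    meanForm_weight S.Q l (hu.state hw (by have := Finset.mem_range.1 hk; omega)).2
  have h2 : ∀ k ∈ Finset.Icc S.d S.N, meanForm μ (S.Rof l) (u (k - S.d)) (u (k - S.d))
      = meanForm μ (S.R 0) (u (k - S.d)) (u (k - S.d))
        + ∑ i, l i * meanForm μ (S.R i.succ) (u (k - S.d)) (u (k - S.d)) := fun k hk =>
    meanForm_weight S.R l
      (hu.control (Finset.mem_Icc.1 hk).2 (Finset.mem_Icc.1 hk).1).2
  have h3 : meanForm μ (S.Fof l) (S.state w u (S.N + 1)) (S.state w u (S.N + 1)) = _ :=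
    meanForm_weight S.F l (hu.state hw le_rfl).2
  rw [Finset.sum_congr rfl h1, Finset.sum_congr rfl h2, h3]
  simp only [lagrangian, J_eq hw hu, mul_sub, mul_add, Finset.sum_add_distrib,
    Finset.sum_sub_distrib, Finset.mul_sum]
  rw [Finset.sum_comm (s := Finset.range (S.N + 1)), Finset.sum_comm (s := Finset.Icc S.d S.N)]
  ring

theorem costToGo_terminal (l : Fin m → ℝ) (x : Ω → Fin n → ℝ) :
    S.costToGo μ w l (S.N + 1) x = meanForm μ (S.Fof l) x x := by
  have : ∀ i, S.L l (S.N + 1 + i) = 0 := fun i => by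
    simp [L, show ¬ (S.N + 1 + i ≤ S.N) by omega]
  simp [costToGo, X_terminal, this, meanForm_zero_matrix]

theorem dualCost_eq (hw : IsWhiteNoise μ w S.sigma) (l : Fin m → ℝ) :
    S.dualCost μ w l = ∑ k ∈ Finset.range S.d,
        meanForm μ (S.Qof l) (S.initState w k) (S.initState w k)
      + S.costToGo μ w l S.d (S.initState w S.d) - ∑ i, l i * S.c i := by
  have hx : ∀ k ≤ S.d, MemLp (S.initState w k) 2 μ := fun k hk =>
    (state_regular hw (k := k) fun j hj => by omega).2
  have hxd := hx S.d le_rfl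
  have h1 : ∀ k ∈ Finset.range S.d,
      Integrable (fun ω => S.initState w k ω ⬝ᵥ S.Qof l *ᵥ S.initState w k ω) μ := fun k hk => by
    have := hx k (Finset.mem_range.1 hk).le
    exact this.integrable_form this _
  have h2 := hxd.integrable_form hxd (S.X l S.d)
  have h3 : ∀ i ∈ Finset.range S.d, Integrable (fun ω => S.initState w S.d ω ⬝ᵥ
      (S.Aᵀ ^ i * S.L l (S.d + i) * S.A ^ i) *ᵥ (μ[S.initState w S.d | pastInfo μ w i]) ω) μ :=
    fun i _ => hxd.integrable_form (hxd.condExp_two _) _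
  unfold dualCost
  have h12 : Integrable (fun ω =>
      (∑ k ∈ Finset.range S.d, S.initState w k ω ⬝ᵥ S.Qof l *ᵥ S.initState w k ω)
      + S.initState w S.d ω ⬝ᵥ S.X l S.d *ᵥ S.initState w S.d ω) μ :=
    (integrable_finsetSum _ h1).add h2
  rw [integral_sub h12 (integrable_finsetSum _ h3),
    integral_add (integrable_finsetSum _ h1) h2,
    integral_finsetSum _ h1, integral_finsetSum _ h3]
  -- At t = d the information level d - d + i of the cost-to-go is i, as in the dual cost.
  simp only [costToGo, meanForm, Nat.sub_self, Nat.zero_add]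
  ring

/-- The one-step identity `costToGo_eq` telescopes along the trajectory from time d on. -/
theorem costToGo_sub (hw : IsWhiteNoise μ w S.sigma) (hW : S.PositiveWeights) {l : Fin m → ℝ}
    (hl : 0 ≤ l) (hu : S.Admissible μ w u) {t : ℕ} (hdt : S.d ≤ t) (ht : t ≤ S.N + 1) :
    ∑ k ∈ Finset.Ico S.d t, meanForm μ (S.Qof l) (S.state w u k) (S.state w u k)
      + ∑ k ∈ Finset.Ico S.d t, meanForm μ (S.Rof l) (u (k - S.d)) (u (k - S.d))
      + S.costToGo μ w l t (S.state w u t)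
    = S.costToGo μ w l S.d (S.state w u S.d)
      + ∑ k ∈ Finset.Ico S.d t, S.excess μ w l k (S.state w u k) (u (k - S.d)) := by
  induction t, hdt using Nat.le_induction with
  | base => simp
  | succ t hdt ih =>
    obtain ⟨hxm, hx⟩ := hu.state hw (t := t) (by omega)
    obtain ⟨hvm, hv⟩ := hu.control (t := t) (by omega) hdt
    have h := costToGo_eq hw hW hl hdt (by omega) hxm hx hvm hv
    -- The control is renamed as the acting input so that the successor is recognised as a state,
    -- and then renamed back.
    rw [← input_of_le u hdt, ← state_succ, input_of_le u hdt] at h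
    have ih := ih (by omega)
    simp only [Finset.sum_Ico_succ_top hdt]
    linarith

/-- The Lagrangian exceeds the dual cost by the losses of the single steps. -/
theorem lagrangian_eq (hw : IsWhiteNoise μ w S.sigma) (hW : S.PositiveWeights) (hN : S.d ≤ S.N)
    {l : Fin m → ℝ} (hl : 0 ≤ l) (hu : S.Admissible μ w u) :
    S.lagrangian μ w l u = S.dualCost μ w l
      + ∑ k ∈ Finset.Icc S.d S.N, S.excess μ w l k (S.state w u k) (u (k - S.d)) := by
  have h := costToGo_sub hw hW hl hu (t := S.N + 1) (by omega) le_rfl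
  have hI : Finset.Ico S.d (S.N + 1) = Finset.Icc S.d S.N := by
    ext; simp
  have h0 : ∀ k ∈ Finset.range S.d,
      meanForm μ (S.Qof l) (S.state w u k) (S.state w u k)
        = meanForm μ (S.Qof l) (S.initState w k) (S.initState w k) := fun k hk => by
    rw [state_eq_initState S w u k (Finset.mem_range.1 hk).le]
  rw [costToGo_terminal] at h
  rw [lagrangian_eq_sum hw hu, dualCost_eq hw, ← state_eq_initState S w u S.d le_rfl,
    ← Finset.sum_range_add_sum_Ico _ (show S.d ≤ S.N + 1 by omega), ← hI,
    Finset.sum_congr rfl h0]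
  linarith

/-! ### The feedback law -/

theorem excess_nonneg (hW : S.PositiveWeights) {l : Fin m → ℝ} (hl : 0 ≤ l) (t : ℕ)
    (x : Ω → Fin n → ℝ) (v : Ω → Fin p → ℝ) : 0 ≤ S.excess μ w l t x v :=
  integral_nonneg fun _ => (hW.Upsilon_posDef hl t).posSemidef.dotProduct_mulVec_self_nonneg _

theorem excess_eq_zero_iff (hW : S.PositiveWeights) {l : Fin m → ℝ} (hl : 0 ≤ l) (t : ℕ)
    {x : Ω → Fin n → ℝ} {v : Ω → Fin p → ℝ} (hx : MemLp x 2 μ) (hv : MemLp v 2 μ) :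
    S.excess μ w l t x v = 0 ↔ v =ᵐ[μ] fun ω =>
      -(((S.Upsilon l t)⁻¹ * S.M l t) *ᵥ (μ[x | pastInfo μ w (t - S.d)]) ω) := by
  have hU := hW.Upsilon_posDef hl t
  have hv' : MemLp (fun ω => v ω
      + ((S.Upsilon l t)⁻¹ * S.M l t) *ᵥ (μ[x | pastInfo μ w (t - S.d)]) ω) 2 μ :=
    hv.add ((hx.condExp_two (pastInfo μ w (t - S.d))).mulVec_left
    ((S.Upsilon l t)⁻¹ * S.M l t))
  rw [excess, meanForm, integral_eq_zero_iff_of_nonneg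
    (fun _ => hU.posSemidef.dotProduct_mulVec_self_nonneg _) (hv'.integrable_form hv' _)]
  refine Filter.eventually_congr (.of_forall fun ω => ⟨fun h => ?_, fun h => ?_⟩)
  · exact eq_neg_of_add_eq_zero_left (hU.eq_zero_of_dotProduct_mulVec_self h)
  · simp [h]

/-- The Lagrangian exceeds the dual cost by a sum of nonnegative losses, so equality forces each of
them to vanish, and a vanishing loss is the feedback law at one time. -/
theorem isFeedback_iff (hw : IsWhiteNoise μ w S.sigma) (hW : S.PositiveWeights) (hN : S.d ≤ S.N)
    {l : Fin m → ℝ} (hl : 0 ≤ l) (hu : S.Admissible μ w u) :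
    S.IsFeedback μ w l u ↔ S.lagrangian μ w l u = S.dualCost μ w l := by
  rw [lagrangian_eq hw hW hN hl hu, add_eq_left,
    Finset.sum_eq_zero_iff_of_nonneg fun k _ => excess_nonneg hW hl k _ _]
  have key : ∀ k, k + S.d ≤ S.N →
      (S.excess μ w l (k + S.d) (S.state w u (k + S.d)) (u k) = 0 ↔ u k =ᵐ[μ] fun ω =>
        -(((S.Upsilon l (k + S.d))⁻¹ * S.M l (k + S.d)) *ᵥ
          (μ[S.state w u (k + S.d) | pastInfo μ w k]) ω)) := fun k hk => by
    have := excess_eq_zero_iff (w := w) hW hl (k + S.d)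
      (hu.state hw (t := k + S.d) (by omega)).2 (hu k hk).2
    rwa [Nat.add_sub_cancel] at this
  constructor
  · intro h t ht
    obtain ⟨h1, h2⟩ := Finset.mem_Icc.1 ht
    obtain ⟨k, rfl⟩ := Nat.exists_eq_add_of_le' h1
    rw [Nat.add_sub_cancel]
    exact (key k h2).2 (h k h2)
  · intro h k hk
    refine (key k hk).1 ?_
    simpa using h (k + S.d) (Finset.mem_Icc.2 ⟨by omega, hk⟩)

theorem dualCost_le (hw : IsWhiteNoise μ w S.sigma) (hW : S.PositiveWeights) (hN : S.d ≤ S.N)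
    {l : Fin m → ℝ} (hl : 0 ≤ l) (hu : S.Admissible μ w u) :
    S.dualCost μ w l ≤ S.lagrangian μ w l u := by
  rw [lagrangian_eq hw hW hN hl hu, le_add_iff_nonneg_right]
  exact Finset.sum_nonneg fun k _ => excess_nonneg hW hl k _ _

variable (S μ w) in
/-- The feedback law, run for the first `k` controls; the later controls vanish. -/
noncomputable def feedbackPrefix (l : Fin m → ℝ) : ℕ → ℕ → Ω → Fin p → ℝ
  | 0 => fun _ _ => 0
  | k + 1 => Function.update (feedbackPrefix l k) k fun ω =>
      -(((S.Upsilon l (k + S.d))⁻¹ * S.M l (k + S.d)) *ᵥ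
        (μ[S.state w (feedbackPrefix l k) (k + S.d) | pastInfo μ w k]) ω)

variable (S μ w) in
/-- The control generated by the feedback law. -/
noncomputable def feedback (l : Fin m → ℝ) (k : ℕ) : Ω → Fin p → ℝ :=
  S.feedbackPrefix μ w l (k + 1) k

theorem feedbackPrefix_eq (l : Fin m → ℝ) {j k : ℕ} (h : j < k) :
    S.feedbackPrefix μ w l k j = S.feedback μ w l j := by
  induction k, h using Nat.le_induction with
  | base => rfl
  | succ k hk ih => rw [feedbackPrefix, Function.update_of_ne (by omega), ih]

/-- The delay resolves the apparent circularity: the state at time k + d depends only on controls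
with index below k, on which the prefix and the full feedback control agree. -/
theorem feedback_eq (l : Fin m → ℝ) (k : ℕ) :
    S.feedback μ w l k = fun ω => -(((S.Upsilon l (k + S.d))⁻¹ * S.M l (k + S.d)) *ᵥ
        (μ[S.state w (S.feedback μ w l) (k + S.d) | pastInfo μ w k]) ω) := by
  rw [feedback, feedbackPrefix, Function.update_self,
    state_congr w fun j hj => feedbackPrefix_eq (μ := μ) (w := w) l (by omega)]

theorem feedback_regular (hw : IsWhiteNoise μ w S.sigma) (l : Fin m → ℝ) (k : ℕ) :
    Measurable[pastInfo μ w k] (S.feedback μ w l k) ∧ MemLp (S.feedback μ w l k) 2 μ := by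
  induction k using Nat.strong_induction_on with
  | _ k ih =>
    rw [feedback_eq]
    have hx := (state_regular hw (S := S) (k := k + S.d) (u := S.feedback μ w l)
      fun j hj => ih j (by omega)).2
    exact ⟨((measurable_condExp_pi _ _).mulVec_left _).neg, ((hx.condExp_two _).mulVec_left _).neg⟩

theorem feedback_admissible (hw : IsWhiteNoise μ w S.sigma) (l : Fin m → ℝ) :
    S.Admissible μ w (S.feedback μ w l) := fun k _ => feedback_regular hw l k

theorem feedback_isFeedback (l : Fin m → ℝ) : S.IsFeedback μ w l (S.feedback μ w l) :=
  fun k _ => .of_eq (feedback_eq l k)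

theorem isLeast_dualCost (hw : IsWhiteNoise μ w S.sigma) (hW : S.PositiveWeights)
    (hN : S.d ≤ S.N) {l : Fin m → ℝ} (hl : 0 ≤ l) :
    IsLeast (S.lagrangian μ w l '' {u | S.Admissible μ w u}) (S.dualCost μ w l) := by
  refine ⟨⟨S.feedback μ w l, feedback_admissible hw l, ?_⟩, ?_⟩
  · exact (isFeedback_iff hw hW hN hl (feedback_admissible hw l)).1 (feedback_isFeedback l)
  · rintro _ ⟨u, hu, rfl⟩
    exact dualCost_le hw hW hN hl hu

end DelayLQ

/-! ### Lagrangian duality -/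

/-- The Lagrangian `J₀(u) + ∑ lᵢ gᵢ(u)`. -/
def lagrangianOf {U : Type*} {m : ℕ} (J₀ : U → ℝ) (g : Fin m → U → ℝ) (l : Fin m → ℝ)
    (u : U) : ℝ :=
  J₀ u + ∑ i, l i * g i u

section Duality

variable {U : Type*} {m : ℕ} {J₀ : U → ℝ} {g : Fin m → U → ℝ} {𝒰 : Set U}
  {φ : (Fin m → ℝ) → ℝ}

theorem lagrangianOf_add_single (l : Fin m → ℝ) (i : Fin m) (t : ℝ) (u : U) :
    lagrangianOf J₀ g (l + Pi.single i t) u = lagrangianOf J₀ g l u + t * g i u := by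
  simp [lagrangianOf, add_mul, Finset.sum_add_distrib, Pi.single_apply, add_assoc]

theorem continuous_lagrangianOf (u : U) : Continuous fun l => lagrangianOf J₀ g l u := by
  unfold lagrangianOf; fun_prop

/-- Under the Slater condition the dual problem has a solution. -/
theorem exists_dual_maximizer
    (hφ : ∀ l, 0 ≤ l → IsLeast (lagrangianOf J₀ g l '' 𝒰) (φ l))
    (hS : ∀ l : Fin m → ℝ, 0 ≤ l → l ≠ 0 → ∃ u ∈ 𝒰, ∑ i, l i * g i u < 0) :
    ∃ l, 0 ≤ l ∧ ∀ l', 0 ≤ l' → φ l' ≤ φ l := by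
  have hle : ∀ {l u}, 0 ≤ l → u ∈ 𝒰 → φ l ≤ lagrangianOf J₀ g l u := fun hl hu =>
    (hφ _ hl).2 ⟨_, hu, rfl⟩
  -- Along each ray the dual function eventually stays below its value at the origin; compactness of
  -- the simplex makes the threshold uniform.
  obtain ⟨T, hT⟩ : ∃ T : ℝ, ∀ t > T, 0 < t → ∀ l ∈ stdSimplex ℝ (Fin m), φ (t • l) < φ 0 := by
    refine (isCompact_stdSimplex ℝ (Fin m)).induction_on
      (p := fun s => ∃ T : ℝ, ∀ t > T, 0 < t → ∀ l ∈ s, φ (t • l) < φ 0)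
      ⟨0, by simp⟩ ?_ ?_ ?_
    · rintro s s' hss ⟨T, hT⟩
      exact ⟨T, fun t ht h0 l hl => hT t ht h0 l (hss hl)⟩
    · rintro s s' ⟨T, hT⟩ ⟨T', hT'⟩
      refine ⟨max T T', fun t ht h0 l hl => ?_⟩
      rcases hl with hl | hl
      · exact hT t ((le_max_left _ _).trans_lt ht) h0 l hl
      · exact hT' t ((le_max_right _ _).trans_lt ht) h0 l hl
    · intro l hl
      have hl0 : l ≠ 0 := by rintro rfl; simpa using hl.2
      obtain ⟨u, hu, hneg⟩ := hS l hl.1 hl0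
      -- Half the Slater slack at l, so that the same control keeps slack `e` for all nearby l'.
      -- There the Lagrangian at t • l' is below J₀ u - t e, hence below φ 0 once t > (J₀ u - φ 0) /
      -- e.
      set e : ℝ := -(∑ i, l i * g i u) / 2 with he
      have hepos : 0 < e := by linarith
      have hcont : Continuous fun l' : Fin m → ℝ => ∑ i, l' i * g i u := by fun_prop
      have hev : ∀ᶠ l' in nhdsWithin l (stdSimplex ℝ (Fin m)), ∑ i, l' i * g i u < -e :=
        (hcont.continuousWithinAt).eventually_lt_const (by linarith)
      refine ⟨_, hev.and self_mem_nhdsWithin, (J₀ u - φ 0) / e, ?_⟩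
      rintro t ht h0 l' ⟨h1, h2⟩
      have h3 := hle (smul_nonneg h0.le (show (0 : Fin m → ℝ) ≤ l' from h2.1)) hu
      have h4 : lagrangianOf J₀ g (t • l') u = J₀ u + t * ∑ i, l' i * g i u := by
        simp [lagrangianOf, Finset.mul_sum, mul_assoc]
      rw [gt_iff_lt, div_lt_iff₀ hepos] at ht
      have h5 := mul_lt_mul_of_pos_left h1 h0
      linarith
  -- Outside this compact set the values lie below φ 0, and `max T 0` ensures that the origin
  -- belongs to it, so a maximiser on it is global.
  set K : Set (Fin m → ℝ) := {l | 0 ≤ l ∧ ∑ i, l i ≤ max T 0} with hK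
  have hKc : IsCompact K := by
    refine (isCompact_Icc (a := (0 : Fin m → ℝ)) (b := fun _ => max T 0)).of_isClosed_subset ?_ ?_
    · exact (isClosed_le continuous_const continuous_id).inter
        (isClosed_le (continuous_finsetSum _ fun i _ => continuous_apply i) continuous_const)
    · rintro l ⟨h0, h1⟩
      exact ⟨h0, fun i => (Finset.single_le_sum (fun j _ => h0 j) (Finset.mem_univ i)).trans h1⟩
  have h0K : (0 : Fin m → ℝ) ∈ K := ⟨le_rfl, by simp⟩
  have husc : UpperSemicontinuousOn φ K := by
    intro l hl y hy
    -- The minimiser at l gives a continuous majorant of φ that touches it at l.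
    obtain ⟨u, hu, hu'⟩ := (hφ l hl.1).1
    have : ∀ᶠ l' in nhdsWithin l K, lagrangianOf J₀ g l' u < y :=
      ((continuous_lagrangianOf u).continuousWithinAt).eventually_lt_const (hu'.trans_lt hy)
    filter_upwards [this, self_mem_nhdsWithin] with l' h1 h2
    exact (hle h2.1 hu).trans_lt h1
  obtain ⟨l, hlK, hl⟩ := husc.exists_isMaxOn ⟨0, h0K⟩ hKc
  refine ⟨l, hlK.1, fun l' hl' => ?_⟩
  by_cases h : l' ∈ K
  · exact hl h
  have hsum : max T 0 < ∑ i, l' i := by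
    by_contra hcon
    exact h ⟨hl', not_lt.1 hcon⟩
  have hpos : 0 < ∑ i, l' i := (le_max_right _ _).trans_lt hsum
  have h1 := hT _ ((le_max_left _ _).trans_lt hsum) hpos ((∑ i, l' i)⁻¹ • l')
    ⟨fun i => mul_nonneg (inv_nonneg.2 hpos.le) (hl' i), by
      simp [← Finset.mul_sum, hpos.ne']⟩
  rw [smul_inv_smul₀ hpos.ne'] at h1
  exact h1.le.trans (hl h0K)

/-- A minimiser of the Lagrangian for an optimal multiplier is feasible and satisfies
complementary slackness, if the Lagrangian grows quadratically away from its minimisers. -/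
theorem kkt_of_dual_maximizer (D : U → U → ℝ) (hD : ∀ u v, 0 ≤ D u v)
    (hφ : ∀ l, 0 ≤ l → IsLeast (lagrangianOf J₀ g l '' 𝒰) (φ l))
    (hgrowth : ∀ l, 0 ≤ l → ∀ u₀ ∈ 𝒰, lagrangianOf J₀ g l u₀ = φ l → ∀ u ∈ 𝒰,
      φ l + D u u₀ / 2 ≤ lagrangianOf J₀ g l u)
    (hcont : ∀ i, ∀ u₀ ∈ 𝒰, ∀ δ > 0, ∃ K ≥ 0, ∀ u ∈ 𝒰, |g i u - g i u₀| ≤ δ + K * D u u₀)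
    {l : Fin m → ℝ} (hl : 0 ≤ l) (hmax : ∀ l', 0 ≤ l' → φ l' ≤ φ l) {u₀ : U} (hu₀ : u₀ ∈ 𝒰)
    (hmin : lagrangianOf J₀ g l u₀ = φ l) (i : Fin m) : g i u₀ ≤ 0 ∧ l i * g i u₀ = 0 := by
  -- moving the multiplier by `t` in the direction `i` cannot increase the dual function
  have key : ∀ t : ℝ, ∀ δ > 0, ∀ K ≥ 0, 0 ≤ l + Pi.single i t → |t| * K ≤ 1 / 2 → t ≠ 0 →
      (∀ u ∈ 𝒰, |g i u - g i u₀| ≤ δ + K * D u u₀) → t * g i u₀ < 2 * |t| * δ := by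
    intro t δ hδ K hK hlt htK ht hKu
    -- Let u minimise the perturbed Lagrangian. Maximality of l and quadratic growth give t g_i(u) ≤
    -- -D u u₀ / 2. Replacing u by u₀ costs at most |t| (δ + K D u u₀), and |t| K ≤ 1/2 absorbs the
    -- gap.
    obtain ⟨u, hu, hu'⟩ := (hφ _ hlt).1
    have h1 := hmax _ hlt
    rw [← hu', lagrangianOf_add_single] at h1
    have h2 := hgrowth l hl u₀ hu₀ hmin u hu
    have h3 : t * (g i u₀ - g i u) ≤ |t| * (δ + K * D u u₀) := by
      refine (le_abs_self _).trans ?_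
      rw [abs_mul, abs_sub_comm]
      exact mul_le_mul_of_nonneg_left (hKu u hu) (abs_nonneg t)
    have h4 := mul_le_mul_of_nonneg_right htK (hD u u₀)
    have h5 : 0 < |t| * δ := mul_pos (abs_pos.2 ht) hδ
    nlinarith
  have hnonpos : g i u₀ ≤ 0 := by
    by_contra! hpos
    obtain ⟨K, hK, hKu⟩ := hcont i u₀ hu₀ (g i u₀ / 2) (by linarith)
    -- This step size gives t K ≤ 1/2 even for K = 0. With δ half of g_i(u₀), `key` reads t g_i(u₀)
    -- < t g_i(u₀).
    have htpos : 0 < 1 / (2 * (K + 1)) := by positivity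
    have h := key (1 / (2 * (K + 1))) _ (by linarith) K hK
      (add_nonneg hl (Pi.single_nonneg.2 htpos.le))
      (by
        rw [abs_of_pos htpos, div_mul_eq_mul_div, div_le_div_iff₀ (by positivity) two_pos]
        linarith) htpos.ne' hKu
    rw [abs_of_pos htpos] at h
    linarith
  refine ⟨hnonpos, ?_⟩
  by_contra hne
  have hli : 0 < l i := lt_of_le_of_ne (hl i) fun h => hne (by rw [← h]; simp)
  have hneg : g i u₀ < 0 := lt_of_le_of_ne hnonpos fun h => hne (by rw [h]; simp)
  obtain ⟨K, hK, hKu⟩ := hcont i u₀ hu₀ (-g i u₀ / 2) (by linarith)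
  -- The multiplier is now decreased; the bound by `l i` keeps it nonnegative.
  set t := min (l i) (1 / (2 * (K + 1))) with ht
  have htpos : 0 < t := lt_min hli (by positivity)
  have h := key (-t) _ (by linarith) K hK
    (by
      intro j
      rcases eq_or_ne j i with rfl | hj
      · have : t ≤ l j := min_le_left _ _
        simpa using this
      · simpa [hj] using hl j)
    (by
      rw [abs_neg, abs_of_pos htpos]
      refine (mul_le_mul_of_nonneg_right (min_le_right _ _) hK).trans ?_
      rw [div_mul_eq_mul_div, div_le_div_iff₀ (by positivity) two_pos]
      linarith) (by linarith) hKu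
  rw [abs_neg, abs_of_pos htpos] at h
  linarith

end Duality

/-! ### Convexity of mean quadratic forms -/

section MeanFormConvexity

variable {Ω ι : Type*} [Fintype ι] [MeasurableSpace Ω] {μ : Measure Ω}

theorem meanForm_nonneg {M : Matrix ι ι ℝ} (hM : M.PosSemidef) (a : Ω → ι → ℝ) :
    0 ≤ meanForm μ M a a :=
  integral_nonneg fun _ => hM.dotProduct_mulVec_self_nonneg _

/-- This is the parallelogram identity, integrated; the subtracted term is the source of uniform
convexity. -/
theorem meanForm_midpoint (M : Matrix ι ι ℝ) {a b : Ω → ι → ℝ} (ha : MemLp a 2 μ)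
    (hb : MemLp b 2 μ) :
    meanForm μ M (fun ω => (1 / 2 : ℝ) • a ω + (1 / 2 : ℝ) • b ω)
      (fun ω => (1 / 2 : ℝ) • a ω + (1 / 2 : ℝ) • b ω)
    = (meanForm μ M a a + meanForm μ M b b) / 2
      - meanForm μ M (fun ω => a ω - b ω) (fun ω => a ω - b ω) / 4 := by
  have hd : MemLp (fun ω => a ω - b ω) 2 μ := ha.sub hb
  have h1 := ha.integrable_form ha M
  have h2 := hb.integrable_form hb M
  have h3 := hd.integrable_form hd M
  simp only [meanForm]
  have h12 : Integrable (fun ω => (a ω ⬝ᵥ M *ᵥ a ω + b ω ⬝ᵥ M *ᵥ b ω) / 2) μ :=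
    (h1.add h2).div_const 2
  rw [← integral_add h1 h2, ← integral_div, ← integral_div, ← integral_sub h12 (h3.div_const 4)]
  refine integral_congr_ae (.of_forall fun ω => ?_)
  have e : a ω - b ω = (1 : ℝ) • a ω + (-1 : ℝ) • b ω := by simp [sub_eq_add_neg]
  simp only [e, dotProduct_mulVec_add_smul]
  ring

theorem meanForm_sub_comm (M : Matrix ι ι ℝ) (a b : Ω → ι → ℝ) :
    meanForm μ M (fun ω => a ω - b ω) (fun ω => a ω - b ω)
      = meanForm μ M (fun ω => b ω - a ω) (fun ω => b ω - a ω) := by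
  refine integral_congr_ae (.of_forall fun ω => ?_)
  simp only
  rw [← neg_sub (b ω), mulVec_neg, neg_dotProduct_neg]

theorem meanForm_le_young {M : Matrix ι ι ℝ} (hM : M.PosSemidef) {a b : Ω → ι → ℝ}
    (ha : MemLp a 2 μ) (hb : MemLp b 2 μ) {ε : ℝ} (hε : 0 < ε) :
    meanForm μ M a a ≤ (1 + ε) * meanForm μ M b b
      + (1 + ε⁻¹) * meanForm μ M (fun ω => a ω - b ω) (fun ω => a ω - b ω) := by
  have hd : MemLp (fun ω => a ω - b ω) 2 μ := ha.sub hb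
  have h2 := (hb.integrable_form hb M).const_mul (1 + ε)
  have h3 := (hd.integrable_form hd M).const_mul (1 + ε⁻¹)
  simp only [meanForm]
  rw [← integral_const_mul, ← integral_const_mul, ← integral_add h2 h3]
  refine integral_mono (ha.integrable_form ha M) (h2.add h3) fun ω => ?_
  obtain ⟨c, hc⟩ : ∃ c, a ω = b ω + c := ⟨a ω - b ω, by abel⟩
  -- Expanding the form at ε b - c, with c = a - b, and dividing by ε bounds the cross terms.
  have h := hM.dotProduct_mulVec_self_nonneg (ε • b ω + (-1 : ℝ) • c)
  have e : b ω + c = (1 : ℝ) • b ω + (1 : ℝ) • c := by simp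
  rw [dotProduct_mulVec_add_smul] at h
  rw [hc, add_sub_cancel_left, e, dotProduct_mulVec_add_smul]
  have h' := mul_nonneg (inv_nonneg.2 hε.le) h
  have hi : ε⁻¹ * ε = 1 := inv_mul_cancel₀ hε.ne'
  have : ε⁻¹ * (ε ^ 2 * (b ω ⬝ᵥ M *ᵥ b ω) + ε * -1 * (b ω ⬝ᵥ M *ᵥ c + c ⬝ᵥ M *ᵥ b ω)
      + (-1) ^ 2 * (c ⬝ᵥ M *ᵥ c)) = (ε⁻¹ * ε) * ε * (b ω ⬝ᵥ M *ᵥ b ω)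
      - (ε⁻¹ * ε) * (b ω ⬝ᵥ M *ᵥ c + c ⬝ᵥ M *ᵥ b ω) + ε⁻¹ * (c ⬝ᵥ M *ᵥ c) := by ring
  rw [this, hi] at h'
  linarith

theorem meanForm_le_mul {M P : Matrix ι ι ℝ} {C : ℝ}
    (hC : ∀ x : ι → ℝ, x ⬝ᵥ M *ᵥ x ≤ C * (x ⬝ᵥ P *ᵥ x)) {a : Ω → ι → ℝ} (ha : MemLp a 2 μ) :
    meanForm μ M a a ≤ C * meanForm μ P a a := by
  simp only [meanForm]
  rw [← integral_const_mul]
  exact integral_mono (ha.integrable_form ha M) ((ha.integrable_form ha P).const_mul C)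
    fun ω => hC _

end MeanFormConvexity

namespace DelayLQ

variable {n p m : ℕ} {S : DelayLQ n p m} {Ω : Type*} [MeasurableSpace Ω] {μ : Measure Ω}
  [IsProbabilityMeasure μ] {w : ℕ → Ω → ℝ} {u v : ℕ → Ω → Fin p → ℝ}

/-! ### Convexity of the functionals -/

variable (S μ) in
/-- The quadratic functional with the weights `Q_i, R_i, F_i`. -/
noncomputable def trajForm (i : Fin (m + 1)) (x : ℕ → Ω → Fin n → ℝ) (v : ℕ → Ω → Fin p → ℝ) : ℝ :=
  ∑ k ∈ Finset.range (S.N + 1), meanForm μ (S.Q i) (x k) (x k)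
    + ∑ k ∈ Finset.Icc S.d S.N, meanForm μ (S.R i) (v (k - S.d)) (v (k - S.d))
    + meanForm μ (S.F i) (x (S.N + 1)) (x (S.N + 1))

variable (S μ w) in
/-- The functional without the linear part, at the difference of two controls. -/
noncomputable def gap (i : Fin (m + 1)) (u v : ℕ → Ω → Fin p → ℝ) : ℝ :=
  S.trajForm μ i (fun k ω => S.state w u k ω - S.state w v k ω) (fun k ω => u k ω - v k ω)

theorem J_eq_trajForm (hw : IsWhiteNoise μ w S.sigma) (hu : S.Admissible μ w u)
    (i : Fin (m + 1)) : S.J μ w i u = S.trajForm μ i (S.state w u) u := J_eq hw hu i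

theorem trajForm_nonneg (hW : S.PositiveWeights) (i : Fin (m + 1)) (x : ℕ → Ω → Fin n → ℝ)
    (v : ℕ → Ω → Fin p → ℝ) : 0 ≤ S.trajForm μ i x v :=
  add_nonneg (add_nonneg
    (Finset.sum_nonneg fun _ _ => meanForm_nonneg (hW.Q i).posSemidef _)
    (Finset.sum_nonneg fun _ _ => meanForm_nonneg (hW.R i).posSemidef _))
    (meanForm_nonneg (hW.F i).posSemidef _)

theorem gap_comm (i : Fin (m + 1)) (u v : ℕ → Ω → Fin p → ℝ) :
    S.gap μ w i u v = S.gap μ w i v u := by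
  unfold gap trajForm
  simp only [meanForm_sub_comm _ (S.state w u _) (S.state w v _), meanForm_sub_comm _ (u _) (v _)]

/-- The midpoint of two controls. -/
noncomputable def midpointControl (u v : ℕ → Ω → Fin p → ℝ) (k : ℕ) (ω : Ω) : Fin p → ℝ :=
  (1 / 2 : ℝ) • u k ω + (1 / 2 : ℝ) • v k ω

theorem Admissible.midpoint (hu : S.Admissible μ w u) (hv : S.Admissible μ w v) :
    S.Admissible μ w (midpointControl u v) := fun k hk =>
  ⟨((hu k hk).1.const_smul (1 / 2 : ℝ)).add ((hv k hk).1.const_smul (1 / 2 : ℝ)),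
    ((hu k hk).2.const_smul (1 / 2 : ℝ)).add ((hv k hk).2.const_smul (1 / 2 : ℝ))⟩

theorem input_midpoint (u v : ℕ → Ω → Fin p → ℝ) (k : ℕ) (ω : Ω) :
    S.input (midpointControl u v) k ω
      = (1 / 2 : ℝ) • S.input u k ω + (1 / 2 : ℝ) • S.input v k ω := by
  unfold input
  split_ifs
  · rw [← add_smul]; norm_num
  · rfl

/-- The dynamics are linear, and the fixed initial data are preserved because the coefficients add
up to one. -/
theorem state_midpoint (u v : ℕ → Ω → Fin p → ℝ) (k : ℕ) :
    S.state w (midpointControl u v) k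
      = fun ω => (1 / 2 : ℝ) • S.state w u k ω + (1 / 2 : ℝ) • S.state w v k ω := by
  induction k with
  | zero =>
    funext ω
    simp only [state]
    rw [← add_smul]; norm_num
  | succ k ih =>
    funext ω
    simp only [state, ih, input_midpoint, mulVec_add, mulVec_smul, smul_add]
    abel

theorem J_midpoint (hw : IsWhiteNoise μ w S.sigma) (hu : S.Admissible μ w u)
    (hv : S.Admissible μ w v) (i : Fin (m + 1)) :
    S.J μ w i (midpointControl u v)
      = (S.J μ w i u + S.J μ w i v) / 2 - S.gap μ w i u v / 4 := by
  have h1 : ∀ k ∈ Finset.range (S.N + 1), _ := fun k hk =>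
    have hk' : k ≤ S.N + 1 := (Finset.mem_range.1 hk).le
    meanForm_midpoint (S.Q i) (hu.state hw hk').2 (hv.state hw hk').2
  have h2 : ∀ k ∈ Finset.Icc S.d S.N, _ := fun k hk =>
    have hk' := Finset.mem_Icc.1 hk
    meanForm_midpoint (S.R i) (hu.control hk'.2 hk'.1).2 (hv.control hk'.2 hk'.1).2
  have h3 := meanForm_midpoint (S.F i) (hu.state hw le_rfl).2 (hv.state hw le_rfl).2
  rw [J_eq_trajForm hw hu, J_eq_trajForm hw hv, J_eq_trajForm hw (hu.midpoint hv)]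
  unfold gap trajForm
  simp only [state_midpoint]
  unfold midpointControl
  rw [Finset.sum_congr rfl h1, Finset.sum_congr rfl h2, h3]
  simp only [Finset.sum_add_distrib, Finset.sum_sub_distrib, ← Finset.sum_div]
  ring

theorem J_le_young (hw : IsWhiteNoise μ w S.sigma) (hW : S.PositiveWeights)
    (hu : S.Admissible μ w u) (hv : S.Admissible μ w v) (i : Fin (m + 1)) {ε : ℝ} (hε : 0 < ε) :
    S.J μ w i u ≤ (1 + ε) * S.J μ w i v + (1 + ε⁻¹) * S.gap μ w i u v := by
  have h1 := Finset.sum_le_sum (s := Finset.range (S.N + 1)) fun k hk =>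
    have hk' : k ≤ S.N + 1 := (Finset.mem_range.1 hk).le
    meanForm_le_young (hW.Q i).posSemidef (hu.state hw hk').2 (hv.state hw hk').2 hε
  have h2 := Finset.sum_le_sum (s := Finset.Icc S.d S.N) fun k hk =>
    have hk' := Finset.mem_Icc.1 hk
    meanForm_le_young (hW.R i).posSemidef (hu.control hk'.2 hk'.1).2 (hv.control hk'.2 hk'.1).2 hε
  have h3 := meanForm_le_young (hW.F i).posSemidef (hu.state hw le_rfl).2 (hv.state hw le_rfl).2 hε
  rw [J_eq_trajForm hw hu, J_eq_trajForm hw hv]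
  unfold gap trajForm
  simp only [Finset.sum_add_distrib, ← Finset.mul_sum] at h1 h2
  linarith

variable (μ w) in
theorem exists_gap_le (hw : IsWhiteNoise μ w S.sigma) (hW : S.PositiveWeights)
    (i : Fin (m + 1)) : ∃ C > 0, ∀ u v, S.Admissible μ w u → S.Admissible μ w v →
      S.gap μ w i u v ≤ C * S.gap μ w 0 u v := by
  obtain ⟨a, ha, hQ⟩ := (hW.Q 0).exists_dominate (S.Q i)
  obtain ⟨b, hb, hR⟩ := (hW.R 0).exists_dominate (S.R i)
  obtain ⟨c, hc, hF⟩ := (hW.F 0).exists_dominate (S.F i)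
  -- The sum of the three constants serves for all three kinds of weight at once.
  refine ⟨a + b + c, by positivity, fun u v hu hv => ?_⟩
  have hx : ∀ k ≤ S.N + 1, MemLp (fun ω => S.state w u k ω - S.state w v k ω) 2 μ :=
    fun k hk => (hu.state hw hk).2.sub (hv.state hw hk).2
  have h1 := Finset.sum_le_sum (s := Finset.range (S.N + 1)) fun k hk =>
    meanForm_le_mul hQ (hx k (Finset.mem_range.1 hk).le)
  have h2 := Finset.sum_le_sum (s := Finset.Icc S.d S.N) fun k hk =>
    have hk' := Finset.mem_Icc.1 hk
    have hc : MemLp (fun ω => u (k - S.d) ω - v (k - S.d) ω) 2 μ :=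
      (hu.control hk'.2 hk'.1).2.sub (hv.control hk'.2 hk'.1).2
    meanForm_le_mul hR hc
  have h3 := meanForm_le_mul hF (hx (S.N + 1) le_rfl)
  have g1 := Finset.sum_nonneg (s := Finset.range (S.N + 1)) fun k _ =>
    meanForm_nonneg (μ := μ) (hW.Q 0).posSemidef fun ω => S.state w u k ω - S.state w v k ω
  have g2 := Finset.sum_nonneg (s := Finset.Icc S.d S.N) fun k _ =>
    meanForm_nonneg (μ := μ) (hW.R 0).posSemidef fun ω => u (k - S.d) ω - v (k - S.d) ω
  have g3 := meanForm_nonneg (μ := μ) (hW.F 0).posSemidef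
    fun ω => S.state w u (S.N + 1) ω - S.state w v (S.N + 1) ω
  unfold gap trajForm
  rw [← Finset.mul_sum] at h1 h2
  refine (add_le_add (add_le_add h1 h2) h3).trans ?_
  rw [mul_add, mul_add]
  exact add_le_add (add_le_add (mul_le_mul_of_nonneg_right (by linarith) g1)
    (mul_le_mul_of_nonneg_right (by linarith) g2)) (mul_le_mul_of_nonneg_right (by linarith) g3)

/-- The functionals are continuous with respect to the gap of the cost. -/
theorem J_continuous (hw : IsWhiteNoise μ w S.sigma) (hW : S.PositiveWeights) (i : Fin (m + 1))
    (hv : S.Admissible μ w v) {δ : ℝ} (hδ : 0 < δ) :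
    ∃ K ≥ 0, ∀ u, S.Admissible μ w u →
      |S.J μ w i u - S.J μ w i v| ≤ δ + K * S.gap μ w 0 u v := by
  obtain ⟨C, hC, hgap⟩ := exists_gap_le μ w hw hW i
  have hJv : 0 ≤ S.J μ w i v := by
    rw [J_eq_trajForm hw hv]; exact trajForm_nonneg hW i _ _
  -- Chosen so that the relative error in Young's inequality is at most δ; the added 1 avoids
  -- division by zero.
  set ε := δ / (S.J μ w i v + 1) with hε
  have hεpos : 0 < ε := by positivity
  have hεJ : ε * S.J μ w i v ≤ δ := by
    rw [hε, div_mul_eq_mul_div, div_le_iff₀ (by positivity)]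
    nlinarith
  refine ⟨(1 + ε⁻¹) * C, by positivity, fun u hu => ?_⟩
  have h1 := J_le_young hw hW hu hv i hεpos
  have h2 := J_le_young hw hW hv hu i hεpos
  rw [gap_comm] at h2
  have h3 := mul_le_mul_of_nonneg_left (hgap u v hu hv) (show 0 ≤ 1 + ε⁻¹ by positivity)
  have h4 : 0 ≤ S.gap μ w 0 u v := trajForm_nonneg hW 0 _ _
  have h5 : 0 ≤ (1 + ε⁻¹) * C * S.gap μ w 0 u v := by positivity
  rw [abs_le]
  constructor
  -- Young's inequality with the roles exchanged has the error ε J(u), which ε J(v) controls only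
  -- when J(u) ≤ J(v); otherwise the lower bound is trivial.
  · rcases le_total (S.J μ w i v) (S.J μ w i u) with h | h
    · linarith
    · have := mul_le_mul_of_nonneg_left h hεpos.le
      linarith
  · linarith

/-- The Lagrangian at the midpoint of u and v is at least the minimum, while the midpoint identity
puts it below the average by at least a quarter of the gap of the cost. -/
theorem lagrangian_growth (hw : IsWhiteNoise μ w S.sigma) (hW : S.PositiveWeights)
    (hN : S.d ≤ S.N) {l : Fin m → ℝ} (hl : 0 ≤ l) (hv : S.Admissible μ w v)
    (hmin : S.lagrangian μ w l v = S.dualCost μ w l) (hu : S.Admissible μ w u) :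
    S.dualCost μ w l + S.gap μ w 0 u v / 2 ≤ S.lagrangian μ w l u := by
  have h := dualCost_le hw hW hN hl (hu.midpoint hv)
  have e : S.lagrangian μ w l (midpointControl u v)
      = (S.lagrangian μ w l u + S.lagrangian μ w l v) / 2
        - (S.gap μ w 0 u v + ∑ i, l i * S.gap μ w i.succ u v) / 4 := by
    simp only [lagrangian, J_midpoint hw hu hv, mul_sub, mul_add, mul_div_assoc',
      Finset.sum_add_distrib, Finset.sum_sub_distrib, ← Finset.sum_div]
    ring
  have hs : 0 ≤ ∑ i, l i * S.gap μ w i.succ u v :=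
    Finset.sum_nonneg fun i _ => mul_nonneg (hl i) (trajForm_nonneg hW _ _ _)
  linarith

/-! ### The constrained problem -/

theorem IsFeedback.kkt (hw : IsWhiteNoise μ w S.sigma) (hW : S.PositiveWeights)
    (hN : S.d ≤ S.N) {l : Fin m → ℝ} (hl : S.IsOptimalMultiplier μ w l)
    (hu : S.Admissible μ w u) (hf : S.IsFeedback μ w l u) (i : Fin m) :
    S.J μ w i.succ u - S.c i ≤ 0 ∧ l i * (S.J μ w i.succ u - S.c i) = 0 := by
  refine kkt_of_dual_maximizer (J₀ := S.J μ w 0) (g := fun i u => S.J μ w i.succ u - S.c i)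
    (𝒰 := {u | S.Admissible μ w u}) (φ := S.dualCost μ w) (S.gap μ w 0)
    (fun u v => trajForm_nonneg hW 0 _ _) (fun l hl => isLeast_dualCost hw hW hN hl)
    (fun l hl v hv hmin u hu => lagrangian_growth hw hW hN hl hv hmin hu)
    (fun i v hv δ hδ => ?_) hl.1 hl.2 hu ((isFeedback_iff hw hW hN hl.1 hu).1 hf) i
  obtain ⟨K, hK, h⟩ := J_continuous hw hW i.succ hv hδ
  exact ⟨K, hK, fun u hu => by simpa using h u hu⟩

/-- Weak duality: nonnegative multipliers weight nonpositive constraint values. -/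
theorem lagrangian_le_of_feasible {l : Fin m → ℝ} (hl : 0 ≤ l) (hu : S.Feasible μ w u) :
    S.lagrangian μ w l u ≤ S.J μ w 0 u := by
  have : ∑ i, l i * (S.J μ w i.succ u - S.c i) ≤ 0 :=
    Finset.sum_nonpos fun i _ => mul_nonpos_of_nonneg_of_nonpos (hl i) (by linarith [hu.2 i])
  unfold lagrangian
  linarith

/-- Complementary slackness makes the cost equal to the dual cost, which weak duality places below
the cost of every feasible control. -/
theorem IsFeedback.isOptimalControl (hw : IsWhiteNoise μ w S.sigma) (hW : S.PositiveWeights)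
    (hN : S.d ≤ S.N) {l : Fin m → ℝ} (hl : S.IsOptimalMultiplier μ w l)
    (hu : S.Admissible μ w u) (hf : S.IsFeedback μ w l u) :
    S.IsOptimalControl μ w u ∧ S.J μ w 0 u = S.dualCost μ w l := by
  have hk := hf.kkt hw hW hN hl hu
  have hJ : S.J μ w 0 u = S.dualCost μ w l := by
    rw [← (isFeedback_iff hw hW hN hl.1 hu).1 hf, lagrangian,
      Finset.sum_eq_zero fun i _ => (hk i).2, add_zero]
  refine ⟨⟨⟨hu, fun i => by linarith [(hk i).1]⟩, fun v hv => ?_⟩, hJ⟩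
  rw [hJ]
  exact (dualCost_le hw hW hN hl.1 hv.1).trans (lagrangian_le_of_feasible hl.1 hv)

/-- An optimal control costs no more than the feedback control, that is, than the dual cost. Its
Lagrangian is therefore minimal, and only the feedback law attains the minimum. -/
theorem IsOptimalControl.isFeedback (hw : IsWhiteNoise μ w S.sigma) (hW : S.PositiveWeights)
    (hN : S.d ≤ S.N) {l : Fin m → ℝ} (hl : S.IsOptimalMultiplier μ w l)
    (hu : S.IsOptimalControl μ w u) : S.IsFeedback μ w l u := by
  obtain ⟨ho, hJ⟩ := (feedback_isFeedback (S := S) (μ := μ) (w := w) l).isOptimalControl hw hW hN hl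
    (feedback_admissible hw l)
  rw [isFeedback_iff hw hW hN hl.1 hu.1.1]
  refine le_antisymm ?_ (dualCost_le hw hW hN hl.1 hu.1.1)
  exact (lagrangian_le_of_feasible hl.1 hu.1).trans ((hu.2 _ ho.1).trans hJ.le)

end DelayLQ

/-! ### The main theorem. -/

theorem theorem2 {n p m : ℕ} (S : DelayLQ n p m) (hd : 0 < S.d) (hN : S.d ≤ S.N)
    (hQ : ∀ i, (S.Q i).PosDef) (hR : ∀ i, (S.R i).PosDef) (hF : ∀ i, (S.F i).PosDef)
    {Ω : Type*} [MeasurableSpace Ω] (μ : Measure Ω) [IsProbabilityMeasure μ]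
    (w : ℕ → Ω → ℝ) (hw : IsWhiteNoise μ w S.sigma) (hS : S.Slater μ w) :
    (∀ l : Fin m → ℝ, 0 ≤ l →
      (∀ k, S.d ≤ k → k ≤ S.N → (S.Upsilon l k).PosDef) ∧
      IsLeast (S.lagrangian μ w l '' {u | S.Admissible μ w u}) (S.dualCost μ w l)) ∧
    (∃ l : Fin m → ℝ, S.IsOptimalMultiplier μ w l) ∧
    (∀ l : Fin m → ℝ, S.IsOptimalMultiplier μ w l →
      (∃ u, S.IsOptimalControl μ w u) ∧
      ∀ u, S.IsOptimalControl μ w u ↔ S.Admissible μ w u ∧ S.IsFeedback μ w l u) := by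
  have hW : S.PositiveWeights := ⟨hQ, hR, hF⟩
  refine ⟨fun l hl => ⟨fun k _ _ => hW.Upsilon_posDef hl k,
    DelayLQ.isLeast_dualCost hw hW hN hl⟩, ?_, fun l hl => ⟨⟨S.feedback μ w l, ?_⟩, fun u =>
    ⟨fun hu => ⟨hu.1.1, hu.isFeedback hw hW hN hl⟩,
      fun hu => (hu.2.isOptimalControl hw hW hN hl hu.1).1⟩⟩⟩
  · exact exists_dual_maximizer (J₀ := S.J μ w 0)
      (g := fun i u => S.J μ w i.succ u - S.c i) (𝒰 := {u | S.Admissible μ w u})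
      (fun l hl => DelayLQ.isLeast_dualCost hw hW hN hl) hS
  · exact ((DelayLQ.feedback_isFeedback l).isOptimalControl hw hW hN hl
      (DelayLQ.feedback_admissible hw l)).1
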